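/- Let $n\ge 3$, let $f:M^n\to\mathbb{R}^m$ be a smooth immersion of an $n$-dimensional smooth manifold, endowed with the induced metric $\langle\cdot,\cdot\rangle$ and its second fundamental form $\alpha$, mean curvature vector field $\mathcal H=\frac1n\operatorname{tr}\alpha$ and normal connection $\nabla^\perp$ with curvature tensor $R^\perp$. Assume that $f$ is umbilic-free (at no point $\alpha=\langle\cdot,\cdot\rangle\mathcal H$) and has flat normal bundle ($R^\perp=0$). Let $\rho>0$ be given by $\rho^2=\frac{n}{n-1}\left(\|\alpha\|^2-n\|\mathcal H\|^2\right)$, let $\langle\cdot,\cdot\rangle^*=\rho^2\langle\cdot,\cdot\rangle$ be the Moebius metric, with curvature tensor $R^*(X,Y)=[\nabla^*_X,\nabla^*_Y]-\nabla^*_{[X,Y]}$, let $\beta=\rho\,(\alpha-\langle\cdot,\cdot\rangle\mathcal H)$ be the Moebius second fundamental form, and let $$\psi(X,Y)=\frac1\rho\langle\beta(X,Y),\mathcal H\rangle+\frac1{2\rho^2}\left(\|\mathrm{grad}^*\rho\|_*^2+\|\mathcal H\|^2\right)\langle X,Y\rangle^*-\frac1\rho\,\mathrm{Hess}^*\rho(X,Y)$$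 be the Blaschke tensor, where $\mathrm{grad}^*$, $\mathrm{Hess}^*$ and $\|\cdot\|_*$ refer to $\langle\cdot,\cdot\rangle^*$. The immersion $f$ is called Moebius semi-parallel if $$R^\perp(X,Y)\beta(Z,W)-\beta(R^*(X,Y)Z,W)-\beta(Z,R^*(X,Y)W)=0\qquad\text{for all tangent } X,Y,Z,W.$$ At $x\in M$ let $\eta_1,\dots,\eta_k$ ($k=k(x)$) be the distinct principal normals of $f$, that is, the normal vectors $\eta$ at $x$ for which $E_\eta=\{X\in T_xM:\alpha(X,Y)=\langle X,Y\rangle\eta\ \text{for all } Y\in T_xM\}\neq\{0\}$, and let $\bar\eta_i=\rho^{-1}(\eta_i-\mathcal H)$ be the corresponding Moebius principal normals. Then $f$ is Moebius semi-parallel if and only if at every point $x\in M$ each $E_{\eta_i}$ consists of eigenvectors of $\psi$ for one eigenvalue $\theta_i$, that is, there are real numbers $\theta_1,\dots,\theta_k$ with $\psi(X,Y)=\theta_i\langle X,Y\rangle^*$ for all $X\in E_{\eta_i}$, $Y\in T_xM$ and $1\le i\le k$, and $$\langle\bar\eta_i,\bar\eta_j\rangle+\theta_i+\theta_j=0\qquad\text{for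 all } 1\le i\ne j\le k.$$ -/

import Mathlib

open scoped Manifold ContDiff

noncomputable section

namespace MoebiusGeometry

/-- The Euclidean space `ℝⁿ`. -/
abbrev Euc (n : ℕ) : Type := EuclideanSpace ℝ (Fin n)

/-- The `i`-th vector of the canonical basis of `ℝⁿ`; it is also the coordinate vector field
`∂ᵢ`. -/
def stdVec {n : ℕ} (i : Fin n) : Euc n := EuclideanSpace.single i (1 : ℝ)

/-! ### Semi-Riemannian calculus on open subsets of `ℝⁿ`

A metric on an open subset of `ℝⁿ` is a function `h : Euc n → Euc n → Euc n → ℝ`, with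
`h u X Y = ⟨X, Y⟩_u`. A vector `X` of `ℝⁿ` is also used for the vector field that is constantly
equal to `X`; the bracket of two such fields vanishes. -/

/-- The matrix `(b(∂ᵢ, ∂ⱼ))ᵢⱼ` of a bilinear form. -/
def gram {n : ℕ} (b : Euc n → Euc n → ℝ) : Matrix (Fin n) (Fin n) ℝ :=
  Matrix.of fun i j => b (stdVec i) (stdVec j)

/-- The vector that is dual to the linear form `φ` with respect to the inner product `b`, that is
the vector `v` with `b v Z = φ Z` for all `Z`: its components are `vⁱ = ∑ⱼ bⁱʲ φ(∂ⱼ)`. -/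
def sharp {n : ℕ} (b : Euc n → Euc n → ℝ) (φ : Euc n → ℝ) : Euc n :=
  ∑ i, ∑ j, ((gram b)⁻¹ i j * φ (stdVec j)) • stdVec i

/-- The Christoffel map of the metric `h`, `Γ_u(X, Y) = (∇_X Y)(u)` for the Levi-Civita connection
`∇` of `h` and constant vector fields `X`, `Y`. By the Koszul formula,
`2 h(∇_X Y, Z) = X h(Y, Z) + Y h(X, Z) - Z h(X, Y)` for constant fields. -/
def christoffel {n : ℕ} (h : Euc n → Euc n → Euc n → ℝ) (u X Y : Euc n) : Euc n :=
  sharp (h u) fun Z =>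
    (1 / 2 : ℝ) * (fderiv ℝ (fun v => h v Y Z) u X + fderiv ℝ (fun v => h v X Z) u Y
      - fderiv ℝ (fun v => h v X Y) u Z)

/-- The Levi-Civita covariant derivative `(∇_X S)(u)` of the vector field `S`. -/
def covDeriv {n : ℕ} (h : Euc n → Euc n → Euc n → ℝ) (X : Euc n) (S : Euc n → Euc n)
    (u : Euc n) : Euc n :=
  fderiv ℝ S u X + christoffel h u X (S u)

/-- The curvature tensor `R(X, Y)Z = ∇_X ∇_Y Z - ∇_Y ∇_X Z - ∇_{[X, Y]} Z` of the metric `h`,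
computed with the constant extensions of `X`, `Y`, `Z`, for which `[X, Y] = 0`. -/
def curvature {n : ℕ} (h : Euc n → Euc n → Euc n → ℝ) (u X Y Z : Euc n) : Euc n :=
  covDeriv h X (covDeriv h Y fun _ => Z) u - covDeriv h Y (covDeriv h X fun _ => Z) u

/-- The gradient of the function `r` with respect to the metric `h`. -/
def grad {n : ℕ} (h : Euc n → Euc n → Euc n → ℝ) (r : Euc n → ℝ) (u : Euc n) : Euc n :=
  sharp (h u) fun Z => fderiv ℝ r u Z

/-- The Hessian `Hess r (X, Y) = X(Y(r)) - (∇_X Y)(r)` of the function `r` with respect to the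
metric `h`. -/
def hess {n : ℕ} (h : Euc n → Euc n → Euc n → ℝ) (r : Euc n → ℝ) (u X Y : Euc n) : ℝ :=
  fderiv ℝ (fun v => fderiv ℝ r v Y) u X - fderiv ℝ r u (christoffel h u X Y)

/-! ### Parametrized submanifolds

Here `F : Euc n → Euc m` is an immersion on a neighbourhood of the point `u`. -/

namespace Param

variable {n m : ℕ}

/-- The metric induced by `F`. -/
def inducedMetric (F : Euc n → Euc m) (u X Y : Euc n) : ℝ :=
  inner ℝ (fderiv ℝ F u X) (fderiv ℝ F u Y)

/-- The normal space of `F` at `u`. -/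
def normalSpace (F : Euc n → Euc m) (u : Euc n) : Submodule ℝ (Euc m) :=
  (LinearMap.range (fderiv ℝ F u).toLinearMap)ᗮ

/-- The orthogonal projection of `ℝᵐ` onto the normal space of `F` at `u`. -/
def normalProj (F : Euc n → Euc m) (u : Euc n) : Euc m →L[ℝ] Euc m :=
  (normalSpace F u).starProjection

/-- The second fundamental form `α(X, Y)`, the normal component of the derivative of `F_* Y` in
the direction `X`. -/
def secondFundamentalForm (F : Euc n → Euc m) (u X Y : Euc n) : Euc m :=
  normalProj F u (fderiv ℝ (fun v => fderiv ℝ F v Y) u X)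

/-- The mean curvature vector `H = (1/n) ∑ᵢⱼ gⁱʲ α(∂ᵢ, ∂ⱼ)`, where `(gⁱʲ)` is the inverse of the
matrix of the induced metric. -/
def meanCurvature (F : Euc n → Euc m) (u : Euc n) : Euc m :=
  (1 / n : ℝ) • ∑ i, ∑ j, (gram (inducedMetric F u))⁻¹ i j •
    secondFundamentalForm F u (stdVec i) (stdVec j)

/-- The squared norm `‖α‖² = ∑ gⁱᵏ gʲˡ ⟨α(∂ᵢ, ∂ⱼ), α(∂ₖ, ∂ₗ)⟩` of the second fundamental form,
which is `∑ᵢⱼ ‖α(Xᵢ, Xⱼ)‖²` for any orthonormal basis `X₁, …, Xₙ` of the tangent space. -/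
def normSqSFF (F : Euc n → Euc m) (u : Euc n) : ℝ :=
  ∑ i, ∑ j, ∑ k, ∑ l,
    (gram (inducedMetric F u))⁻¹ i k * (gram (inducedMetric F u))⁻¹ j l *
      inner ℝ (secondFundamentalForm F u (stdVec i) (stdVec j))
        (secondFundamentalForm F u (stdVec k) (stdVec l))

/-- The function `ρ ≥ 0` with `ρ² = (n / (n - 1)) (‖α‖² - n ‖H‖²)`. -/
def rho (F : Euc n → Euc m) (u : Euc n) : ℝ :=
  Real.sqrt ((n : ℝ) / ((n : ℝ) - 1) * (normSqSFF F u - (n : ℝ) * ‖meanCurvature F u‖ ^ 2))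

/-- The Moebius metric `⟨X, Y⟩* = ρ² ⟨X, Y⟩`. -/
def moebiusMetric (F : Euc n → Euc m) (u X Y : Euc n) : ℝ :=
  rho F u ^ 2 * inducedMetric F u X Y

/-- The Moebius second fundamental form `β = ρ (α - ⟨·, ·⟩ H)`. -/
def beta (F : Euc n → Euc m) (u X Y : Euc n) : Euc m :=
  rho F u • (secondFundamentalForm F u X Y - inducedMetric F u X Y • meanCurvature F u)

/-- The Blaschke tensor `ψ(X, Y) = ρ⁻¹ ⟨β(X, Y), H⟩
+ (2ρ²)⁻¹ (‖grad* ρ‖*² + ‖H‖²) ⟨X, Y⟩* - ρ⁻¹ Hess* ρ (X, Y)`. -/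
def blaschke (F : Euc n → Euc m) (u X Y : Euc n) : ℝ :=
  1 / rho F u * inner ℝ (beta F u X Y) (meanCurvature F u)
    + 1 / (2 * rho F u ^ 2) *
        (moebiusMetric F u (grad (moebiusMetric F) (rho F) u) (grad (moebiusMetric F) (rho F) u)
          + ‖meanCurvature F u‖ ^ 2) * moebiusMetric F u X Y
    - 1 / rho F u * hess (moebiusMetric F) (rho F) u X Y

/-- The normal connection, `(∇^⊥_X ξ)(u)` for a normal vector field `ξ`. -/
def normalDeriv (F : Euc n → Euc m) (X : Euc n) (ξ : Euc n → Euc m) (u : Euc n) : Euc m :=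
  normalProj F u (fderiv ℝ ξ u X)

/-- The curvature tensor `R^⊥(X, Y)ξ = ∇^⊥_X ∇^⊥_Y ξ - ∇^⊥_Y ∇^⊥_X ξ - ∇^⊥_{[X, Y]} ξ` of the
normal connection, at a normal vector `ξ` at `u`. It is computed with the constant extensions of
`X`, `Y` (so `[X, Y] = 0`) and with the normal vector field `v ↦ (ξ)^⊥_v` that extends `ξ`. -/
def normalCurvature (F : Euc n → Euc m) (u X Y : Euc n) (ξ : Euc m) : Euc m :=
  normalDeriv F X (normalDeriv F Y fun v => normalProj F v ξ) u
    - normalDeriv F Y (normalDeriv F X fun v => normalProj F v ξ) u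

/-- The van der Waerden-Bortolotti curvature operator of the Moebius metric acting on `β`,
`(R̄ · β)(X, Y, Z, W) = R^⊥(X, Y)β(Z, W) - β(R*(X, Y)Z, W) - β(Z, R*(X, Y)W)`. -/
def curvatureActBeta (F : Euc n → Euc m) (u X Y Z W : Euc n) : Euc m :=
  normalCurvature F u X Y (beta F u Z W)
    - beta F u (curvature (moebiusMetric F) u X Y Z) W
    - beta F u Z (curvature (moebiusMetric F) u X Y W)

end Param

/-! ### Immersed manifolds

For an immersion `f : M → ℝᵐ` of an `n`-dimensional manifold, the tensors at `x : M` are computed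
in the preferred chart at `x`. This is the chart through which Mathlib identifies the tangent
space `TangentSpace (𝓡 n) x` with `ℝⁿ`, so that they are tensors on `TangentSpace (𝓡 n) x`. -/

section Manifold

variable {n m : ℕ} {M : Type*} [TopologicalSpace M] [ChartedSpace (Euc n) M]

variable (n) in
/-- The coordinates of `x` in the preferred chart at `x`. -/
def coord (x : M) : Euc n := extChartAt (𝓡 n) x x

variable (n) in
/-- The map `f` in the preferred chart at `x`. -/
def localRep (f : M → Euc m) (x : M) : Euc n → Euc m := f ∘ (extChartAt (𝓡 n) x).symm

variable (n) in
/-- `f` is an immersion of class `C^∞`. -/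
def IsSmoothImmersion (f : M → Euc m) : Prop :=
  ContMDiff (𝓡 n) 𝓘(ℝ, Euc m) ∞ f ∧
    ∀ x, Function.Injective (mfderiv (𝓡 n) 𝓘(ℝ, Euc m) f x)

/-- The metric induced by `f`. -/
def inducedMetric (f : M → Euc m) (x : M) (X Y : TangentSpace (𝓡 n) x) : ℝ :=
  Param.inducedMetric (localRep n f x) (coord n x) X Y

variable (n) in
/-- The normal space of `f` at `x`. -/
def normalSpace (f : M → Euc m) (x : M) : Submodule ℝ (Euc m) :=
  Param.normalSpace (localRep n f x) (coord n x)

/-- The second fundamental form `α` of `f`. -/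
def secondFundamentalForm (f : M → Euc m) (x : M) (X Y : TangentSpace (𝓡 n) x) : Euc m :=
  Param.secondFundamentalForm (localRep n f x) (coord n x) X Y

variable (n) in
/-- The mean curvature vector field `H` of `f`. -/
def meanCurvature (f : M → Euc m) (x : M) : Euc m :=
  Param.meanCurvature (localRep n f x) (coord n x)

variable (n) in
/-- The function `ρ ≥ 0` with `ρ² = (n / (n - 1)) (‖α‖² - n ‖H‖²)`. -/
def rho (f : M → Euc m) (x : M) : ℝ := Param.rho (localRep n f x) (coord n x)

/-- The Moebius metric `⟨·, ·⟩*` of `f`. -/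
def moebiusMetric (f : M → Euc m) (x : M) (X Y : TangentSpace (𝓡 n) x) : ℝ :=
  Param.moebiusMetric (localRep n f x) (coord n x) X Y

/-- The Blaschke tensor `ψ` of `f`. -/
def blaschke (f : M → Euc m) (x : M) (X Y : TangentSpace (𝓡 n) x) : ℝ :=
  Param.blaschke (localRep n f x) (coord n x) X Y

/-- The curvature tensor `R^⊥` of the normal connection of `f`. -/
def normalCurvature (f : M → Euc m) (x : M) (X Y : TangentSpace (𝓡 n) x) (ξ : Euc m) : Euc m :=
  Param.normalCurvature (localRep n f x) (coord n x) X Y ξ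

/-- The tensor `R̄ · β` of `f`. -/
def curvatureActBeta (f : M → Euc m) (x : M) (X Y Z W : TangentSpace (𝓡 n) x) : Euc m :=
  Param.curvatureActBeta (localRep n f x) (coord n x) X Y Z W

variable (n) in
/-- `x` is an umbilical point of `f`: `α(X, Y) = ⟨X, Y⟩ H` for all `X`, `Y` tangent at `x`. -/
def IsUmbilicalPoint (f : M → Euc m) (x : M) : Prop :=
  ∀ X Y : TangentSpace (𝓡 n) x,
    secondFundamentalForm f x X Y = inducedMetric f x X Y • meanCurvature n f x

variable (n) in
/-- `f` has no umbilical points. -/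
def IsUmbilicFree (f : M → Euc m) : Prop := ∀ x, ¬ IsUmbilicalPoint n f x

variable (n) in
/-- `f` has flat normal bundle: `R^⊥ = 0`. -/
def HasFlatNormalBundle (f : M → Euc m) : Prop :=
  ∀ (x : M) (X Y : TangentSpace (𝓡 n) x), ∀ ξ ∈ normalSpace n f x, normalCurvature f x X Y ξ = 0

variable (n) in
/-- `f` is Moebius semi-parallel: `R̄ · β = 0`. -/
def IsMoebiusSemiParallel (f : M → Euc m) : Prop :=
  ∀ (x : M) (X Y Z W : TangentSpace (𝓡 n) x), curvatureActBeta f x X Y Z W = 0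

/-- The set `E_η(x)` of the tangent vectors `X` at `x` with `α(X, Y) = ⟨X, Y⟩ η` for all `Y`. -/
def eigenspace (f : M → Euc m) (x : M) (η : Euc m) : Set (TangentSpace (𝓡 n) x) :=
  {X | ∀ Y : TangentSpace (𝓡 n) x, secondFundamentalForm f x X Y = inducedMetric f x X Y • η}

variable (n) in
/-- The principal normals of `f` at `x`: the normal vectors `η` at `x` with `E_η(x) ≠ 0`. -/
def principalNormals (f : M → Euc m) (x : M) : Set (Euc m) :=
  {η | η ∈ normalSpace n f x ∧
    ∃ X : TangentSpace (𝓡 n) x, X ≠ 0 ∧ X ∈ eigenspace f x η}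

variable (n) in
/-- The Moebius principal normal `η̄ = ρ⁻¹ (η - H)` that belongs to the principal normal `η`. -/
def moebiusNormal (f : M → Euc m) (x : M) (η : Euc m) : Euc m :=
  (rho n f x)⁻¹ • (η - meanCurvature n f x)

end Manifold

end MoebiusGeometry

end

/-!
The statement is pointwise, so it suffices to work at one point `u` of a chart, with a smooth map
`F : ℝⁿ → ℝᵐ` that is an immersion at `u`. Three facts carry the proof.

*The Gauss equation of the Moebius metric* (`moebius_gauss_equation`). The Moebius metric is induced
by the lift `Ψ = ρ (F, ‖F‖² / 2, 1)` of `F` to the light cone of the Lorentz space `ℝᵐ × ℝ × ℝ`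
(`isPullbackNear_moebius`). For every metric `h` that is pulled back from a symmetric bilinear form
`B` by a map `Ψ`, the curvature satisfies the Gauss equation with the second fundamental form
`S(X, Y) = ∂_X ∂_Y Ψ - Ψ_*(∇_X Y)` (`gauss_equation`). For the lift to the light cone,
`B(S(X, Y), S(Z, W)) = ⟨β(X, Y), β(Z, W)⟩ + ψ(X, Y) ⟨Z, W⟩* + ψ(Z, W) ⟨X, Y⟩*` (`lorentz_sff`), and
this is where the Blaschke tensor `ψ` enters. No formula for the conformal change of the curvature
is needed.

*The Ricci equation* (`shape_shape_comm`). The normal curvature is the normal part of the commutator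
of two derivatives of the normal projection, and the Weingarten formula turns its vanishing into the
commutation of the shape operators. Hence the tangent space is spanned by the spaces `E_η`
(`iSup_principalSpace`), and `β(X, Y) = ⟨X, Y⟩* η̄` for `X` in `E_η`.

*Linear algebra* (`act_eq_zero_iff_exists`). For `Z` in `E_η` and `W` in `E_ζ` the action of the
curvature on `β` is `⟨R*(X, Y)Z, W⟩* (ζ̄ - η̄)`, so semi-parallelity says that `⟨R*(X, Y)Z, W⟩* = 0`
whenever `η ≠ ζ`. By the Gauss equation this holds under the stated condition on `ψ`. Conversely,
with `Y = Z` it shows that `ψ(X, W)` is a multiple of `⟨X, W⟩*`, up to the term with `ψ(Z, W)`. That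
term vanishes since `n ≥ 3` leaves a principal direction orthogonal to `Z` and `W`
(`exists_orthogonal`), which can take the place of one of them. There are at least two principal
normals, because otherwise the point would be umbilical.
-/

open Filter Topology

namespace MoebiusGeometry

/-! ### Nondegenerate forms and their dual vectors -/

section Gram

variable {n : ℕ}

/-- `b` is a nondegenerate symmetric bilinear form on `ℝⁿ`; nondegeneracy is expressed by the
determinant of the Gram matrix. -/
structure IsInnerForm (b : Euc n → Euc n → ℝ) : Prop where
  symm : ∀ X Y, b X Y = b Y X
  add_left : ∀ X Y Z, b (X + Y) Z = b X Z + b Y Z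
  smul_left : ∀ (c : ℝ) X Z, b (c • X) Z = c * b X Z
  det_ne_zero : (gram b).det ≠ 0

lemma sum_coord_smul_stdVec (X : Euc n) : ∑ i, X i • stdVec i = X := by
  ext j
  simp [stdVec, Finset.sum_apply, Pi.single_apply]

namespace IsInnerForm

variable {b : Euc n → Euc n → ℝ} (hb : IsInnerForm b)
include hb

lemma add_right (X Y Z : Euc n) : b X (Y + Z) = b X Y + b X Z := by
  rw [hb.symm, hb.add_left, hb.symm Y, hb.symm Z]

lemma smul_right (c : ℝ) (X Z : Euc n) : b X (c • Z) = c * b X Z := by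
  rw [hb.symm, hb.smul_left, hb.symm Z]

/-- The form as a bundled bilinear map. -/
def toBilin : Euc n →ₗ[ℝ] Euc n →ₗ[ℝ] ℝ :=
  LinearMap.mk₂ ℝ b hb.add_left hb.smul_left hb.add_right fun c X Z => hb.smul_right c X Z

lemma toBilin_apply (X Y : Euc n) : hb.toBilin X Y = b X Y := rfl

lemma sub_left (X Y Z : Euc n) : b (X - Y) Z = b X Z - b Y Z := by
  simp only [← hb.toBilin_apply, map_sub, LinearMap.sub_apply]

lemma zero_left (Z : Euc n) : b 0 Z = 0 := by
  simp only [← hb.toBilin_apply, map_zero, LinearMap.zero_apply]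

lemma sum_left {ι : Type*} (s : Finset ι) (f : ι → Euc n) (Z : Euc n) :
    b (∑ i ∈ s, f i) Z = ∑ i ∈ s, b (f i) Z := by
  simp only [← hb.toBilin_apply, map_sum, LinearMap.sum_apply]

lemma gram_symm (i j : Fin n) : gram b i j = gram b j i := hb.symm _ _

lemma inv_gram_symm (i j : Fin n) : (gram b)⁻¹ i j = (gram b)⁻¹ j i := by
  have h : (gram b).transpose = gram b := by ext i j; exact hb.gram_symm j i
  conv_rhs => rw [← h, ← Matrix.transpose_nonsing_inv]
  rfl

lemma sum_inv_gram_mul (j k : Fin n) :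
    ∑ i, (gram b)⁻¹ i j * gram b i k = if j = k then 1 else 0 := by
  have h := congrFun (congrFun (Matrix.nonsing_inv_mul (gram b)
    (isUnit_iff_ne_zero.2 hb.det_ne_zero)) j) k
  rw [Matrix.mul_apply, Matrix.one_apply] at h
  rw [← h]
  exact Finset.sum_congr rfl fun i _ => by rw [hb.inv_gram_symm]

/-- The defining property of the dual vector of a linear form. -/
lemma apply_sharp {φ : Euc n → ℝ} (hφ : IsLinearMap ℝ φ) (Z : Euc n) : b (sharp b φ) Z = φ Z := by
  have key : ∀ k, b (sharp b φ) (stdVec k) = φ (stdVec k) := by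
    intro k
    simp only [sharp, hb.sum_left, hb.smul_left]
    rw [Finset.sum_comm]
    have : ∀ j, ∑ i, (gram b)⁻¹ i j * φ (stdVec j) * b (stdVec i) (stdVec k)
        = φ (stdVec j) * if j = k then 1 else 0 := by
      intro j
      rw [← hb.sum_inv_gram_mul, Finset.mul_sum]
      exact Finset.sum_congr rfl fun i _ => by simp only [gram, Matrix.of_apply]; ring
    simp [this]
  have h1 : b (sharp b φ) Z = hb.toBilin (sharp b φ) (∑ i, Z i • stdVec i) := by
    rw [sum_coord_smul_stdVec, toBilin_apply]
  have h2 : φ Z = hφ.mk' φ (∑ i, Z i • stdVec i) := by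
    rw [sum_coord_smul_stdVec, IsLinearMap.mk'_apply]
  rw [h1, h2, map_sum, map_sum]
  refine Finset.sum_congr rfl fun i _ => ?_
  rw [map_smul, map_smul, toBilin_apply, key, IsLinearMap.mk'_apply]

lemma eq_zero_of_forall {X : Euc n} (h : ∀ Z, b X Z = 0) : X = 0 := by
  have h0 : Matrix.vecMul (fun i => X i) (gram b) = 0 := by
    ext k
    have := h (stdVec k)
    rw [← sum_coord_smul_stdVec X, hb.sum_left] at this
    simpa [Matrix.vecMul, dotProduct, hb.smul_left, gram] using this
  have h1 := Matrix.eq_zero_of_vecMul_eq_zero hb.det_ne_zero h0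
  ext i
  exact congrFun h1 i

lemma ext_right {X Y : Euc n} (h : ∀ Z, b X Z = b Y Z) : X = Y :=
  sub_eq_zero.1 <| hb.eq_zero_of_forall fun Z => by rw [hb.sub_left, h, sub_self]

end IsInnerForm

/-- Positive definite symmetric bilinear forms are nondegenerate. -/
lemma isInnerForm_of_pos {b : Euc n → Euc n → ℝ} (hs : ∀ X Y, b X Y = b Y X)
    (ha : ∀ X Y Z, b (X + Y) Z = b X Z + b Y Z) (hc : ∀ (c : ℝ) X Z, b (c • X) Z = c * b X Z)
    (hpos : ∀ X, b X X = 0 → X = 0) : IsInnerForm b := by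
  refine ⟨hs, ha, hc, fun h0 => ?_⟩
  obtain ⟨x, hx, hx0⟩ := Matrix.exists_vecMul_eq_zero_iff.2 h0
  let B : Euc n →ₗ[ℝ] Euc n →ₗ[ℝ] ℝ := LinearMap.mk₂ ℝ b ha hc
    (fun X Y Z => by rw [hs, ha, hs Y, hs Z]) (fun c X Z => by
      change b X (c • Z) = c * b X Z
      rw [hs, hc, hs Z])
  have hk : ∀ k, B (∑ i, x i • stdVec i) (stdVec k) = 0 := by
    intro k
    have := congrFun hx0 k
    simp only [Matrix.vecMul, dotProduct, Pi.zero_apply] at this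
    rw [map_sum, LinearMap.sum_apply, ← this]
    exact Finset.sum_congr rfl fun i _ => by
      rw [map_smul, LinearMap.smul_apply, smul_eq_mul]; rfl
  have h1 := hpos (∑ i, x i • stdVec i) (by
    change B _ _ = 0
    conv_lhs => rw [map_sum]
    exact Finset.sum_eq_zero fun i _ => by rw [map_smul, hk, smul_zero])
  apply hx
  ext i
  have := congrArg (fun X : Euc n => X i) h1
  simpa [stdVec, Finset.sum_apply, Pi.single_apply] using this

end Gram

section Smooth

variable {n : ℕ} {E : Type*} [NormedAddCommGroup E] [NormedSpace ℝ E]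

lemma contDiffAt_det {ι : Type*} [Fintype ι] [DecidableEq ι] {A : E → Matrix ι ι ℝ} {u : E}
    (hA : ∀ i j, ContDiffAt ℝ ∞ (fun v => A v i j) u) :
    ContDiffAt ℝ ∞ (fun v => (A v).det) u := by
  simp only [Matrix.det_apply]
  refine ContDiffAt.sum fun σ _ => ContDiffAt.const_smul _ ?_
  exact contDiffAt_prod fun i _ => hA _ _

lemma contDiffAt_inv_apply {ι : Type*} [Fintype ι] [DecidableEq ι] {A : E → Matrix ι ι ℝ} {u : E}
    (hA : ∀ i j, ContDiffAt ℝ ∞ (fun v => A v i j) u) (hu : (A u).det ≠ 0) (i j : ι) :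
    ContDiffAt ℝ ∞ (fun v => (A v)⁻¹ i j) u := by
  simp only [Matrix.inv_def, Matrix.smul_apply, Ring.inverse_eq_inv', smul_eq_mul,
    Matrix.adjugate_apply]
  refine ((contDiffAt_det hA).inv hu).mul (contDiffAt_det fun k l => ?_)
  simp only [Matrix.updateRow_apply]
  split_ifs
  · exact contDiffAt_const
  · exact hA k l

lemma contDiffAt_sharp {h : E → Euc n → Euc n → ℝ} {φ : E → Euc n → ℝ} {u : E}
    (hh : ∀ X Y, ContDiffAt ℝ ∞ (fun v => h v X Y) u) (hu : (gram (h u)).det ≠ 0)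
    (hφ : ∀ X, ContDiffAt ℝ ∞ (fun v => φ v X) u) :
    ContDiffAt ℝ ∞ (fun v => sharp (h v) (φ v)) u := by
  unfold sharp
  refine ContDiffAt.sum fun i _ => ContDiffAt.sum fun j _ => ContDiffAt.fun_smul ?_ contDiffAt_const
  exact (contDiffAt_inv_apply (A := fun v => gram (h v)) (fun k l => hh _ _) hu i j).mul (hφ _)

lemma contDiffAt_fderiv_apply {E' : Type*} [NormedAddCommGroup E'] [NormedSpace ℝ E'] {f : E → E'}
    {u : E} (hf : ContDiffAt ℝ ∞ f u) (X : E) : ContDiffAt ℝ ∞ (fun v => fderiv ℝ f v X) u :=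
  (hf.fderiv_right (m := ∞) le_rfl).clm_apply contDiffAt_const

lemma fderiv_fderiv_comm {E' : Type*} [NormedAddCommGroup E'] [NormedSpace ℝ E'] {f : E → E'}
    {u : E} (hf : ContDiffAt ℝ ∞ f u) (X Y : E) :
    fderiv ℝ (fun v => fderiv ℝ f v Y) u X = fderiv ℝ (fun v => fderiv ℝ f v X) u Y := by
  have h1 : DifferentiableAt ℝ (fderiv ℝ f) u :=
    (hf.fderiv_right (m := ∞) le_rfl).differentiableAt (by simp)
  have h2 : ∀ A B : E, fderiv ℝ (fun v => fderiv ℝ f v A) u B = fderiv ℝ (fderiv ℝ f) u B A := by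
    intro A B
    rw [fderiv_clm_apply h1 (differentiableAt_const A)]
    simp
  rw [h2, h2]
  exact (hf.isSymmSndFDerivAt (by
    rw [minSmoothness_of_isRCLikeNormedField]
    exact WithTop.coe_le_coe.2 (le_top : (2 : ℕ∞) ≤ ⊤))).eq X Y

end Smooth

/-! ### The Gauss equation of a pulled back metric -/

section Pullback

variable {n : ℕ} {E : Type*} [NormedAddCommGroup E] [NormedSpace ℝ E]

/-- The second derivative of `Ψ`, as the derivative in the direction `X` of the partial derivative
in the direction `Y`. -/
noncomputable def sndDeriv {E' : Type*} [NormedAddCommGroup E'] [NormedSpace ℝ E']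
    (Ψ : E' → E) (u X Y : E') : E :=
  fderiv ℝ (fun v => fderiv ℝ Ψ v Y) u X

lemma fderiv_bilin_apply {E' F : Type*} [NormedAddCommGroup E'] [NormedSpace ℝ E']
    [NormedAddCommGroup F] [NormedSpace ℝ F]
    (B : E →L[ℝ] E →L[ℝ] F) {f g : E' → E} {u : E'} (hf : DifferentiableAt ℝ f u)
    (hg : DifferentiableAt ℝ g u) (X : E') :
    fderiv ℝ (fun v => B (f v) (g v)) u X
      = B (fderiv ℝ f u X) (g u) + B (f u) (fderiv ℝ g u X) := by
  rw [(B.hasFDerivAt_of_bilinear hf.hasFDerivAt hg.hasFDerivAt).fderiv]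
  simp [add_comm]

section SndDeriv

variable {Ψ : Euc n → E} {u : Euc n}

lemma sndDeriv_add_right (hΨ : ContDiffAt ℝ ∞ Ψ u) (X Y Z : Euc n) :
    sndDeriv Ψ u X (Y + Z) = sndDeriv Ψ u X Y + sndDeriv Ψ u X Z := by
  unfold sndDeriv
  simp only [map_add]
  rw [fderiv_fun_add ((contDiffAt_fderiv_apply hΨ Y).differentiableAt (by simp))
    ((contDiffAt_fderiv_apply hΨ Z).differentiableAt (by simp))]
  rfl

lemma sndDeriv_smul_right (hΨ : ContDiffAt ℝ ∞ Ψ u) (c : ℝ) (X Y : Euc n) :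
    sndDeriv Ψ u X (c • Y) = c • sndDeriv Ψ u X Y := by
  unfold sndDeriv
  simp only [map_smul]
  rw [fderiv_fun_const_smul ((contDiffAt_fderiv_apply hΨ Y).differentiableAt (by simp))]
  rfl

lemma sndDeriv_comm (hΨ : ContDiffAt ℝ ∞ Ψ u) (X Y : Euc n) :
    sndDeriv Ψ u X Y = sndDeriv Ψ u Y X := fderiv_fderiv_comm hΨ X Y

lemma contDiffAt_sndDeriv (hΨ : ContDiffAt ℝ ∞ Ψ u) (X Y : Euc n) :
    ContDiffAt ℝ ∞ (fun v => sndDeriv Ψ v X Y) u :=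
  contDiffAt_fderiv_apply (contDiffAt_fderiv_apply hΨ Y) X

end SndDeriv

/-- Near `u`, the metric `h` is the nondegenerate pullback by the smooth map `Ψ` of the symmetric
bilinear form `B`. The form `B` may be indefinite or degenerate. -/
structure IsPullbackNear (h : Euc n → Euc n → Euc n → ℝ) (B : E →L[ℝ] E →L[ℝ] ℝ)
    (Ψ : Euc n → E) (u : Euc n) : Prop where
  symm : ∀ x y, B x y = B y x
  smooth : ∀ᶠ v in 𝓝 u, ContDiffAt ℝ ∞ Ψ v
  eq : ∀ᶠ v in 𝓝 u, ∀ X Y, h v X Y = B (fderiv ℝ Ψ v X) (fderiv ℝ Ψ v Y)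
  det_ne_zero : (gram (h u)).det ≠ 0

namespace IsPullbackNear

variable {h : Euc n → Euc n → Euc n → ℝ} {B : E →L[ℝ] E →L[ℝ] ℝ} {Ψ : Euc n → E} {u : Euc n}

lemma contDiffAt_metric (H : IsPullbackNear h B Ψ u) (X Y : Euc n) :
    ContDiffAt ℝ ∞ (fun v => h v X Y) u := by
  have hΨ := H.smooth.self_of_nhds
  refine ContDiffAt.congr_of_eventuallyEq
    (f := fun v => B (fderiv ℝ Ψ v X) (fderiv ℝ Ψ v Y)) ?_ (H.eq.mono fun v hv => hv X Y)
  exact (contDiffAt_const.clm_apply (contDiffAt_fderiv_apply hΨ X)).clm_apply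
    (contDiffAt_fderiv_apply hΨ Y)

lemma isInnerForm (H : IsPullbackNear h B Ψ u) : IsInnerForm (h u) where
  symm X Y := by simp only [H.eq.self_of_nhds, H.symm]
  add_left X Y Z := by simp [H.eq.self_of_nhds]
  smul_left c X Z := by simp [H.eq.self_of_nhds]
  det_ne_zero := H.det_ne_zero

lemma eventually (H : IsPullbackNear h B Ψ u) : ∀ᶠ v in 𝓝 u, IsPullbackNear h B Ψ v := by
  have hc : ContinuousAt (fun v => (gram (h v)).det) u :=
    (contDiffAt_det (A := fun v => gram (h v)) fun i j => H.contDiffAt_metric _ _).continuousAt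
  filter_upwards [H.smooth.eventually_nhds, H.eq.eventually_nhds, hc.eventually_ne H.det_ne_zero]
    with v h1 h2 h3
  exact ⟨H.symm, h1, h2, h3⟩

lemma fderiv_metric (H : IsPullbackNear h B Ψ u) (X Y Z : Euc n) :
    fderiv ℝ (fun v => h v Y Z) u X
      = B (sndDeriv Ψ u X Y) (fderiv ℝ Ψ u Z) + B (fderiv ℝ Ψ u Y) (sndDeriv Ψ u X Z) := by
  have hΨ := H.smooth.self_of_nhds
  have h1 : (fun v => h v Y Z) =ᶠ[𝓝 u] fun v => B (fderiv ℝ Ψ v Y) (fderiv ℝ Ψ v Z) :=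
    H.eq.mono fun v hv => hv Y Z
  rw [h1.fderiv_eq, fderiv_bilin_apply B
    ((contDiffAt_fderiv_apply hΨ Y).differentiableAt (by simp))
    ((contDiffAt_fderiv_apply hΨ Z).differentiableAt (by simp))]
  rfl

/-- The linearity in `Z` of the right-hand side of the Koszul formula. -/
lemma isLinearMap_koszul (H : IsPullbackNear h B Ψ u) (X Y : Euc n) :
    IsLinearMap ℝ fun Z => (1 / 2 : ℝ) * (fderiv ℝ (fun v => h v Y Z) u X
      + fderiv ℝ (fun v => h v X Z) u Y - fderiv ℝ (fun v => h v X Y) u Z) := by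
  have hΨ := H.smooth.self_of_nhds
  constructor
  · intro Z W
    simp only [H.fderiv_metric, sndDeriv_add_right hΨ, map_add, sndDeriv_comm hΨ (Z + W),
      sndDeriv_comm hΨ Z, sndDeriv_comm hΨ W, add_apply]
    ring
  · intro c Z
    simp only [H.fderiv_metric, sndDeriv_smul_right hΨ, map_smul, sndDeriv_comm hΨ (c • Z),
      sndDeriv_comm hΨ Z, smul_apply, smul_eq_mul]
    ring

/-- The Levi-Civita connection of a pulled back metric: `∇_X Y` is the tangential part of the
second derivative of the map. -/
lemma apply_christoffel (H : IsPullbackNear h B Ψ u) (X Y Z : Euc n) :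
    h u (christoffel h u X Y) Z = B (sndDeriv Ψ u X Y) (fderiv ℝ Ψ u Z) := by
  have hΨ := H.smooth.self_of_nhds
  rw [christoffel, H.isInnerForm.apply_sharp (H.isLinearMap_koszul X Y)]
  simp only [H.fderiv_metric]
  rw [sndDeriv_comm hΨ Y X, sndDeriv_comm hΨ Z X, sndDeriv_comm hΨ Z Y,
    H.symm (fderiv ℝ Ψ u Y), H.symm (fderiv ℝ Ψ u X)]
  ring

lemma contDiffAt_christoffel (H : IsPullbackNear h B Ψ u) (X Y : Euc n) :
    ContDiffAt ℝ ∞ (fun v => christoffel h v X Y) u := by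
  unfold christoffel
  refine contDiffAt_sharp H.contDiffAt_metric H.det_ne_zero fun Z => ?_
  exact contDiffAt_const.mul
    (((contDiffAt_fderiv_apply (H.contDiffAt_metric _ _) _).add
      (contDiffAt_fderiv_apply (H.contDiffAt_metric _ _) _)).sub
      (contDiffAt_fderiv_apply (H.contDiffAt_metric _ _) _))

/-- The component of the second derivative of `Ψ` that is `B`-orthogonal to the image of the
derivative of `Ψ`: the second fundamental form of `Ψ`. -/
lemma sndDeriv_sub_orthogonal (H : IsPullbackNear h B Ψ u) (X Y Z : Euc n) :
    B (sndDeriv Ψ u X Y - fderiv ℝ Ψ u (christoffel h u X Y)) (fderiv ℝ Ψ u Z) = 0 := by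
  rw [map_sub, sub_apply, ← H.apply_christoffel, H.eq.self_of_nhds, sub_self]

/-- The iterated covariant derivative. The first term on the right-hand side is symmetric in `X` and
`Y`, so it disappears from the curvature. -/
lemma apply_covDeriv_covDeriv (H : IsPullbackNear h B Ψ u) (X Y Z W : Euc n) :
    h u (covDeriv h X (covDeriv h Y fun _ => Z) u) W
      = B (fderiv ℝ (fun v => sndDeriv Ψ v Y Z) u X) (fderiv ℝ Ψ u W)
        + B (sndDeriv Ψ u Y Z - fderiv ℝ Ψ u (christoffel h u Y Z))
          (sndDeriv Ψ u X W - fderiv ℝ Ψ u (christoffel h u X W)) := by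
  have hΨ := H.smooth.self_of_nhds
  have hΓ := (H.contDiffAt_christoffel Y Z).differentiableAt (by simp)
  have hD : DifferentiableAt ℝ (fderiv ℝ Ψ) u :=
    (hΨ.fderiv_right (m := ∞) le_rfl).differentiableAt (by simp)
  have hcov : (covDeriv h Y fun _ => Z) = fun v => christoffel h v Y Z := by
    funext v; simp [covDeriv]
  -- differentiate the identity that characterises the Christoffel map
  have hev : (fun v => B (fderiv ℝ Ψ v (christoffel h v Y Z)) (fderiv ℝ Ψ v W))
      =ᶠ[𝓝 u] fun v => B (sndDeriv Ψ v Y Z) (fderiv ℝ Ψ v W) := by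
    filter_upwards [H.eventually] with v hv
    rw [← hv.eq.self_of_nhds, hv.apply_christoffel]
  have hd := congrArg (fun L : Euc n →L[ℝ] ℝ => L X) hev.fderiv_eq
  have hW := (contDiffAt_fderiv_apply hΨ W).differentiableAt (n := ∞) (by simp)
  rw [fderiv_bilin_apply B (hD.clm_apply hΓ) hW,
    fderiv_bilin_apply B ((contDiffAt_sndDeriv hΨ Y Z).differentiableAt (by simp)) hW] at hd
  have h2 : fderiv ℝ (fun v => fderiv ℝ Ψ v (christoffel h v Y Z)) u X
      = fderiv ℝ Ψ u (fderiv ℝ (fun v => christoffel h v Y Z) u X)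
        + sndDeriv Ψ u X (christoffel h u Y Z) := by
    rw [fderiv_clm_apply hD hΓ, sndDeriv, fderiv_clm_apply hD (differentiableAt_const _)]
    simp
  rw [h2] at hd
  rw [hcov, covDeriv, H.isInnerForm.add_left, H.apply_christoffel, H.eq.self_of_nhds]
  have h3 : B (sndDeriv Ψ u Y Z - fderiv ℝ Ψ u (christoffel h u Y Z))
      (fderiv ℝ Ψ u (christoffel h u X W)) = 0 := H.sndDeriv_sub_orthogonal _ _ _
  rw [map_sub (B (sndDeriv Ψ u Y Z - fderiv ℝ Ψ u (christoffel h u Y Z))), h3]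
  simp only [map_add, add_apply, map_sub, sub_apply] at hd ⊢
  change _ + B _ (sndDeriv Ψ u X W) = _ + B _ (sndDeriv Ψ u X W) at hd
  linarith

/-- The Gauss equation for a pulled back metric. -/
theorem gauss_equation (H : IsPullbackNear h B Ψ u) (X Y Z W : Euc n) :
    h u (curvature h u X Y Z) W
      = B (sndDeriv Ψ u Y Z - fderiv ℝ Ψ u (christoffel h u Y Z))
          (sndDeriv Ψ u X W - fderiv ℝ Ψ u (christoffel h u X W))
        - B (sndDeriv Ψ u X Z - fderiv ℝ Ψ u (christoffel h u X Z))
          (sndDeriv Ψ u Y W - fderiv ℝ Ψ u (christoffel h u Y W)) := by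
  have hcomm : fderiv ℝ (fun v => sndDeriv Ψ v Y Z) u X
      = fderiv ℝ (fun v => sndDeriv Ψ v X Z) u Y :=
    fderiv_fderiv_comm (contDiffAt_fderiv_apply H.smooth.self_of_nhds Z) X Y
  rw [curvature, H.isInnerForm.sub_left, H.apply_covDeriv_covDeriv, H.apply_covDeriv_covDeriv,
    hcomm]
  ring

end IsPullbackNear

end Pullback

/-! ### The normal projection and the Ricci equation -/

namespace Param

variable {n m : ℕ}

/-- `F` is smooth near `u` and an immersion at `u`. -/
structure IsImmersionNear (F : Euc n → Euc m) (u : Euc n) : Prop where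
  smooth : ∀ᶠ v in 𝓝 u, ContDiffAt ℝ ∞ F v
  injective : Function.Injective (fderiv ℝ F u)

variable {F : Euc n → Euc m} {u : Euc n}

namespace IsImmersionNear

lemma isPullbackNear (H : IsImmersionNear F u) :
    IsPullbackNear (inducedMetric F) (innerSL ℝ) F u where
  symm x y := real_inner_comm y x
  smooth := H.smooth
  eq := Eventually.of_forall fun _ _ _ => rfl
  det_ne_zero := (isInnerForm_of_pos (b := inducedMetric F u) (fun _ _ => real_inner_comm _ _)
    (fun X Y Z => by simp [inducedMetric, inner_add_left])
    (fun c X Z => by simp [inducedMetric, inner_smul_left])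
    (fun X hX => H.injective (by rw [map_zero]; exact inner_self_eq_zero.1 hX))).det_ne_zero

lemma isInnerForm (H : IsImmersionNear F u) : IsInnerForm (inducedMetric F u) :=
  H.isPullbackNear.isInnerForm

lemma eventually (H : IsImmersionNear F u) : ∀ᶠ v in 𝓝 u, IsImmersionNear F v := by
  filter_upwards [H.isPullbackNear.eventually] with v hv
  refine ⟨hv.smooth, (injective_iff_map_eq_zero _).2 fun X hX => ?_⟩
  refine hv.isInnerForm.eq_zero_of_forall fun Z => ?_
  simp [inducedMetric, hX]

/-- The normal projection in terms of the metric: the tangential part of `ξ` is the image of the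
vector dual to `Z ↦ ⟨ξ, F_* Z⟩`. -/
lemma normalProj_eq (H : IsImmersionNear F u) (ξ : Euc m) :
    normalProj F u ξ
      = ξ - fderiv ℝ F u (sharp (inducedMetric F u) fun Z => inner ℝ ξ (fderiv ℝ F u Z)) := by
  have hlin : IsLinearMap ℝ fun Z => inner ℝ ξ (fderiv ℝ F u Z) :=
    ⟨fun X Y => by simp [inner_add_right], fun c X => by simp [inner_smul_right]⟩
  refine (normalSpace F u).eq_starProjection_of_mem_of_inner_eq_zero ?_ ?_
  · rintro _ ⟨Z, rfl⟩
    have := H.isInnerForm.apply_sharp hlin Z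
    rw [inducedMetric] at this
    change inner ℝ (fderiv ℝ F u Z) _ = 0
    rw [real_inner_comm, inner_sub_left, this, sub_self]
  · intro w hw
    rw [sub_sub_cancel]
    exact hw _ ⟨_, rfl⟩

lemma contDiffAt_normalProj_apply (H : IsImmersionNear F u) (ξ : Euc m) :
    ContDiffAt ℝ ∞ (fun v => normalProj F v ξ) u := by
  have hF := H.smooth.self_of_nhds
  refine ContDiffAt.congr_of_eventuallyEq ?_ (H.eventually.mono fun v hv => hv.normalProj_eq ξ)
  refine contDiffAt_const.sub ((hF.fderiv_right (m := ∞) le_rfl).clm_apply ?_)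
  exact contDiffAt_sharp H.isPullbackNear.contDiffAt_metric H.isPullbackNear.det_ne_zero
    fun Z => contDiffAt_const.inner ℝ (contDiffAt_fderiv_apply hF Z)

lemma contDiffAt_normalProj (H : IsImmersionNear F u) : ContDiffAt ℝ ∞ (normalProj F) u := by
  obtain ⟨s, hs, hso, hus⟩ := eventually_nhds_iff.1 H.eventually
  refine ContDiffOn.contDiffAt (s := s) (contDiffOn_clm_apply.2 fun ξ v hv => ?_)
    (hso.mem_nhds hus)
  exact ((hs v hv).contDiffAt_normalProj_apply ξ).contDiffWithinAt

lemma contDiffAt_secondFundamentalForm (H : IsImmersionNear F u) (X Y : Euc n) :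
    ContDiffAt ℝ ∞ (fun v => secondFundamentalForm F v X Y) u :=
  H.contDiffAt_normalProj.clm_apply
    (contDiffAt_sndDeriv H.smooth.self_of_nhds X Y)

end IsImmersionNear

lemma normalProj_mem (ξ : Euc m) : normalProj F u ξ ∈ normalSpace F u :=
  Submodule.starProjection_apply_mem _ _

lemma inner_fderiv_of_mem_normalSpace {ξ : Euc m} (hξ : ξ ∈ normalSpace F u) (Z : Euc n) :
    inner ℝ ξ (fderiv ℝ F u Z) = 0 := by
  rw [real_inner_comm]; exact hξ _ ⟨Z, rfl⟩

lemma normalProj_of_mem {ξ : Euc m} (hξ : ξ ∈ normalSpace F u) : normalProj F u ξ = ξ :=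
  Submodule.starProjection_eq_self_iff.2 hξ

lemma normalProj_normalProj (ξ : Euc m) :
    normalProj F u (normalProj F u ξ) = normalProj F u ξ := normalProj_of_mem (normalProj_mem ξ)

lemma inner_normalProj_left (ξ ζ : Euc m) :
    inner ℝ (normalProj F u ξ) ζ = inner ℝ ξ (normalProj F u ζ) :=
  Submodule.inner_starProjection_left_eq_right _ _ _

lemma normalProj_fderiv (Z : Euc n) : normalProj F u (fderiv ℝ F u Z) = 0 := by
  refine ext_inner_left ℝ fun ξ => ?_
  rw [← inner_normalProj_left, inner_fderiv_of_mem_normalSpace (normalProj_mem ξ), inner_zero_right]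

lemma secondFundamentalForm_mem (X Y : Euc n) :
    secondFundamentalForm F u X Y ∈ normalSpace F u := normalProj_mem _

namespace IsImmersionNear

lemma differentiableAt_normalProj (H : IsImmersionNear F u) : DifferentiableAt ℝ (normalProj F) u :=
  H.contDiffAt_normalProj.differentiableAt (by simp)

lemma secondFundamentalForm_comm (H : IsImmersionNear F u) (X Y : Euc n) :
    secondFundamentalForm F u X Y = secondFundamentalForm F u Y X := by
  unfold secondFundamentalForm
  rw [fderiv_fderiv_comm H.smooth.self_of_nhds]

lemma secondFundamentalForm_add_right (H : IsImmersionNear F u) (X Y Z : Euc n) :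
    secondFundamentalForm F u X (Y + Z)
      = secondFundamentalForm F u X Y + secondFundamentalForm F u X Z := by
  change normalProj F u (sndDeriv F u X (Y + Z)) = _
  rw [sndDeriv_add_right H.smooth.self_of_nhds, map_add]
  rfl

lemma secondFundamentalForm_smul_right (H : IsImmersionNear F u) (c : ℝ) (X Y : Euc n) :
    secondFundamentalForm F u X (c • Y) = c • secondFundamentalForm F u X Y := by
  change normalProj F u (sndDeriv F u X (c • Y)) = _
  rw [sndDeriv_smul_right H.smooth.self_of_nhds, map_smul]
  rfl

/-- The second fundamental form as a bundled bilinear map. -/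
noncomputable def sff (H : IsImmersionNear F u) : Euc n →ₗ[ℝ] Euc n →ₗ[ℝ] Euc m :=
  LinearMap.mk₂ ℝ (secondFundamentalForm F u)
    (fun X Y Z => by
      rw [H.secondFundamentalForm_comm, H.secondFundamentalForm_add_right,
        H.secondFundamentalForm_comm Z, H.secondFundamentalForm_comm Z])
    (fun c X Z => by
      rw [H.secondFundamentalForm_comm, H.secondFundamentalForm_smul_right,
        H.secondFundamentalForm_comm Z])
    H.secondFundamentalForm_add_right H.secondFundamentalForm_smul_right

lemma sff_apply (H : IsImmersionNear F u) (X Y : Euc n) :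
    H.sff X Y = secondFundamentalForm F u X Y := rfl

lemma fderiv_normalProj_apply (H : IsImmersionNear F u) (X : Euc n) (ξ : Euc m) :
    fderiv ℝ (fun v => normalProj F v ξ) u X = fderiv ℝ (normalProj F) u X ξ := by
  rw [fderiv_clm_apply H.differentiableAt_normalProj (differentiableAt_const _)]
  simp

lemma inner_fderiv_normalProj (H : IsImmersionNear F u) (X : Euc n) (ξ ζ : Euc m) :
    inner ℝ (fderiv ℝ (normalProj F) u X ξ) ζ = inner ℝ ξ (fderiv ℝ (normalProj F) u X ζ) := by
  have hd : ∀ η : Euc m, DifferentiableAt ℝ (fun v => normalProj F v η) u := fun η =>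
    (H.contDiffAt_normalProj_apply η).differentiableAt (by simp)
  have h1 := fderiv_inner_apply ℝ (hd ξ) (differentiableAt_const ζ) X
  have h2 := fderiv_inner_apply ℝ (differentiableAt_const ξ) (hd ζ) X
  simp only [inner_normalProj_left] at h1
  rw [h1] at h2
  simpa [H.fderiv_normalProj_apply] using h2

/-- The derivative of the identity `P ∘ P = P` of the normal projection. -/
lemma normalProj_fderiv_normalProj (H : IsImmersionNear F u) (X : Euc n) (ξ : Euc m) :
    fderiv ℝ (normalProj F) u X (normalProj F u ξ) + normalProj F u (fderiv ℝ (normalProj F) u X ξ)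
      = fderiv ℝ (normalProj F) u X ξ := by
  have h1 : (fun v => normalProj F v (normalProj F v ξ)) = fun v => normalProj F v ξ :=
    funext fun v => normalProj_normalProj ξ
  have h2 := congrArg (fun f => fderiv ℝ f u X) h1
  rw [fderiv_clm_apply H.differentiableAt_normalProj
    ((H.contDiffAt_normalProj_apply ξ).differentiableAt (by simp)), H.fderiv_normalProj_apply] at h2
  refine Eq.trans ?_ h2
  simp [H.fderiv_normalProj_apply, add_comm]

/-- The derivative of the identity `(F_* Z)^⊥ = 0`. -/
lemma fderiv_normalProj_fderiv (H : IsImmersionNear F u) (X Z : Euc n) :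
    fderiv ℝ (normalProj F) u X (fderiv ℝ F u Z) = -secondFundamentalForm F u X Z := by
  have h1 : (fun v => normalProj F v (fderiv ℝ F v Z)) = fun _ => (0 : Euc m) :=
    funext fun v => normalProj_fderiv Z
  have h2 := congrArg (fun f => fderiv ℝ f u X) h1
  rw [fderiv_clm_apply H.differentiableAt_normalProj
    ((contDiffAt_fderiv_apply H.smooth.self_of_nhds Z).differentiableAt (by simp))] at h2
  rw [eq_neg_iff_add_eq_zero, add_comm]
  simpa [secondFundamentalForm] using h2

/-- The shape operator `A_ξ`. -/
noncomputable def shape (_H : IsImmersionNear F u) (ξ : Euc m) (X : Euc n) : Euc n :=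
  sharp (inducedMetric F u) fun Z => inner ℝ ξ (secondFundamentalForm F u X Z)

lemma inducedMetric_shape (H : IsImmersionNear F u) (ξ : Euc m) (X Z : Euc n) :
    inducedMetric F u (H.shape ξ X) Z = inner ℝ ξ (secondFundamentalForm F u X Z) := by
  refine H.isInnerForm.apply_sharp (φ := fun Z => inner ℝ ξ (secondFundamentalForm F u X Z)) ?_ Z
  simp only [← H.sff_apply]
  exact ⟨fun Y Z => by rw [map_add, inner_add_right],
    fun c Z => by rw [map_smul, inner_smul_right, smul_eq_mul]⟩

/-- The Weingarten formula. -/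
lemma fderiv_normalProj_of_mem (H : IsImmersionNear F u) {ξ : Euc m} (hξ : ξ ∈ normalSpace F u)
    (X : Euc n) : fderiv ℝ (normalProj F) u X ξ = -fderiv ℝ F u (H.shape ξ X) := by
  have h1 : normalProj F u (fderiv ℝ (normalProj F) u X ξ) = 0 := by
    have := H.normalProj_fderiv_normalProj X ξ
    rwa [normalProj_of_mem hξ, add_eq_left] at this
  have h2 : fderiv ℝ (normalProj F) u X ξ ∈ (normalSpace F u)ᗮ := by
    intro ζ hζ
    rw [← normalProj_of_mem hζ, inner_normalProj_left, h1, inner_zero_right]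
  rw [normalSpace, Submodule.orthogonal_orthogonal] at h2
  obtain ⟨a, ha⟩ := h2
  change fderiv ℝ F u a = _ at ha
  rw [← ha, ← map_neg]
  congr 1
  refine H.isInnerForm.ext_right fun Z => ?_
  rw [← neg_one_smul ℝ (H.shape ξ X), H.isInnerForm.smul_left, H.inducedMetric_shape,
    inducedMetric, ha, H.inner_fderiv_normalProj, H.fderiv_normalProj_fderiv, inner_neg_right]
  ring

/-- The normal curvature is the normal part of the commutator of the derivatives of the normal
projection. -/
lemma normalCurvature_eq (H : IsImmersionNear F u) (X Y : Euc n) (ξ : Euc m) :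
    normalCurvature F u X Y ξ
      = normalProj F u (fderiv ℝ (normalProj F) u X (fderiv ℝ (normalProj F) u Y ξ))
        - normalProj F u (fderiv ℝ (normalProj F) u Y (fderiv ℝ (normalProj F) u X ξ)) := by
  have key : ∀ A C : Euc n, normalDeriv F A (normalDeriv F C fun v => normalProj F v ξ) u
      = normalProj F u (fderiv ℝ (normalProj F) u A (fderiv ℝ (normalProj F) u C ξ))
        + normalProj F u (sndDeriv (fun v => normalProj F v ξ) u A C) := by
    intro A C
    unfold normalDeriv
    rw [fderiv_clm_apply H.differentiableAt_normalProj ((contDiffAt_fderiv_apply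
      (H.contDiffAt_normalProj_apply ξ) C).differentiableAt (by simp))]
    simp only [add_apply, ContinuousLinearMap.comp_apply, ContinuousLinearMap.flip_apply, map_add,
      normalProj_normalProj, H.fderiv_normalProj_apply]
    exact add_comm _ _
  rw [normalCurvature, key, key,
    sndDeriv_comm (H.contDiffAt_normalProj_apply ξ) X Y, add_sub_add_right_eq_sub]

lemma shape_normalProj (H : IsImmersionNear F u) (ξ : Euc m) (X : Euc n) :
    H.shape (normalProj F u ξ) X = H.shape ξ X := by
  refine H.isInnerForm.ext_right fun Z => ?_
  rw [H.inducedMetric_shape, H.inducedMetric_shape, inner_normalProj_left,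
    normalProj_of_mem (secondFundamentalForm_mem X Z)]

lemma inducedMetric_shape_comm (H : IsImmersionNear F u) (ξ : Euc m) (X Z : Euc n) :
    inducedMetric F u (H.shape ξ X) Z = inducedMetric F u X (H.shape ξ Z) := by
  rw [H.isInnerForm.symm X, H.inducedMetric_shape, H.inducedMetric_shape,
    H.secondFundamentalForm_comm]

/-- The Ricci equation in the flat case: if the normal curvature vanishes, then the shape operators
commute. -/
theorem shape_shape_comm (H : IsImmersionNear F u)
    (hflat : ∀ X Y, ∀ ξ ∈ normalSpace F u, normalCurvature F u X Y ξ = 0) (ξ ζ : Euc m)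
    (X : Euc n) : H.shape ξ (H.shape ζ X) = H.shape ζ (H.shape ξ X) := by
  have key : ∀ A C : Euc n, inner ℝ (normalProj F u (fderiv ℝ (normalProj F) u A
      (fderiv ℝ (normalProj F) u C (normalProj F u ξ)))) (normalProj F u ζ)
        = inducedMetric F u (H.shape ξ C) (H.shape ζ A) := by
    intro A C
    rw [inner_normalProj_left, normalProj_normalProj, H.inner_fderiv_normalProj,
      H.fderiv_normalProj_of_mem (normalProj_mem _), H.fderiv_normalProj_of_mem (normalProj_mem _),
      inner_neg_neg, H.shape_normalProj, H.shape_normalProj]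
    rfl
  refine H.isInnerForm.ext_right fun Y => ?_
  rw [H.inducedMetric_shape_comm ξ, H.inducedMetric_shape_comm ζ (H.shape ξ X)]
  have h := congrArg (fun w => inner ℝ w (normalProj F u ζ))
    (hflat X Y _ (normalProj_mem (F := F) (u := u) ξ))
  simp only [H.normalCurvature_eq, inner_sub_left, key, inner_zero_left] at h
  rw [H.isInnerForm.symm (H.shape ζ X)]
  linarith

end IsImmersionNear

end Param

/-! ### The function `ρ` -/

section Trace

variable {n m : ℕ}

/-- The norm that an inner product induces on `ℝᵐ`-valued bilinear forms is definite: the Kronecker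
square of the inverse Gram matrix is positive definite, and this is applied to each component. -/
lemma sum_inv_gram_mul_inner_pos {b : Euc n → Euc n → ℝ} (hb : IsInnerForm b)
    (hpos : ∀ X, X ≠ 0 → 0 < b X X) {φ : Fin n → Fin n → Euc m} (hφ : φ ≠ 0) :
    0 < ∑ i, ∑ j, ∑ k, ∑ l, (gram b)⁻¹ i k * (gram b)⁻¹ j l * inner ℝ (φ i j) (φ k l) := by
  have hG : (gram b).PosDef := by
    refine Matrix.PosDef.of_dotProduct_mulVec_pos (by ext i j; exact hb.gram_symm j i) ?_
    intro x hx
    have hX : (∑ i, x i • stdVec i : Euc n) ≠ 0 := by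
      intro h0
      apply hx
      ext i
      have := congrArg (fun X : Euc n => X i) h0
      simpa [stdVec, Finset.sum_apply, Pi.single_apply] using this
    refine (hpos _ hX).trans_eq ?_
    simp only [hb.sum_left, hb.smul_left, dotProduct, Matrix.mulVec, star_trivial]
    refine Finset.sum_congr rfl fun i _ => ?_
    rw [hb.symm, hb.sum_left]
    congr 1
    refine Finset.sum_congr rfl fun j _ => ?_
    rw [hb.smul_left, hb.symm, mul_comm]
    rfl
  have hK := hG.inv.kronecker hG.inv
  set A := (gram b)⁻¹
  have hsum : ∑ i, ∑ j, ∑ k, ∑ l, A i k * A j l * inner ℝ (φ i j) (φ k l)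
      = ∑ c : Fin m, (star fun p : Fin n × Fin n => φ p.1 p.2 c) ⬝ᵥ
          (Matrix.kronecker A A).mulVec fun p => φ p.1 p.2 c := by
    simp only [dotProduct, Matrix.mulVec, Fintype.sum_prod_type, Finset.mul_sum, star_trivial,
      PiLp.inner_apply, Matrix.kroneckerMap_apply, Matrix.kronecker]
    rw [Finset.sum_comm (s := (Finset.univ : Finset (Fin m)))]
    refine Finset.sum_congr rfl fun i _ => ?_
    rw [Finset.sum_comm (s := (Finset.univ : Finset (Fin m)))]
    refine Finset.sum_congr rfl fun j _ => ?_
    rw [Finset.sum_comm (s := (Finset.univ : Finset (Fin m)))]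
    refine Finset.sum_congr rfl fun k _ => ?_
    rw [Finset.sum_comm (s := (Finset.univ : Finset (Fin m)))]
    refine Finset.sum_congr rfl fun l _ => Finset.sum_congr rfl fun c _ => ?_
    simp
    ring
  rw [hsum]
  obtain ⟨c, hc⟩ : ∃ c : Fin m, (fun p : Fin n × Fin n => φ p.1 p.2 c) ≠ 0 := by
    by_contra! h
    apply hφ
    ext i j c
    exact congrFun (h c) (i, j)
  refine Finset.sum_pos' (fun c _ => hK.posSemidef.dotProduct_mulVec_nonneg _)
    ⟨c, Finset.mem_univ _, hK.dotProduct_mulVec_pos hc⟩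

/-- The squared norm of the trace-free part of a tensor with values in `ℝᵐ`. -/
lemma sum_inv_gram_traceFree {b : Euc n → Euc n → ℝ} (hb : IsInnerForm b)
    (a : Fin n → Fin n → Euc m) {w : Euc m}
    (hw : (n : ℝ) • w = ∑ i, ∑ j, (gram b)⁻¹ i j • a i j) :
    ∑ i, ∑ j, ∑ k, ∑ l, (gram b)⁻¹ i k * (gram b)⁻¹ j l *
        inner ℝ (a i j - gram b i j • w) (a k l - gram b k l • w)
      = ∑ i, ∑ j, ∑ k, ∑ l, (gram b)⁻¹ i k * (gram b)⁻¹ j l * inner ℝ (a i j) (a k l)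
        - n * ‖w‖ ^ 2 := by
  have hδ : ∀ j k, ∑ l, (gram b)⁻¹ j l * gram b k l = if j = k then 1 else 0 := by
    intro j k
    rw [← hb.sum_inv_gram_mul]
    exact Finset.sum_congr rfl fun l _ => by rw [hb.inv_gram_symm, hb.gram_symm]
  have hA := hb.inv_gram_symm
  set A := (gram b)⁻¹
  set G := gram b
  have ht : ∑ i, ∑ j, A i j * inner ℝ (a i j) w = n * ‖w‖ ^ 2 := by
    have h := congrArg (fun z => inner ℝ z w) hw
    simp only [sum_inner, real_inner_smul_left, real_inner_self_eq_norm_sq] at h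
    exact h.symm
  have h2 : ∑ i, ∑ j, ∑ k, ∑ l, A i k * A j l * (G k l * inner ℝ (a i j) w) = n * ‖w‖ ^ 2 := by
    rw [← ht]
    refine Finset.sum_congr rfl fun i _ => Finset.sum_congr rfl fun j _ => ?_
    have : ∀ k, ∑ l, A i k * A j l * (G k l * inner ℝ (a i j) w)
        = A i k * inner ℝ (a i j) w * if j = k then 1 else 0 := by
      intro k
      rw [← hδ, Finset.mul_sum]
      exact Finset.sum_congr rfl fun l _ => by ring
    simp [this]
  have h3 : ∑ i, ∑ j, ∑ k, ∑ l, A i k * A j l * (G i j * inner ℝ (a k l) w) = n * ‖w‖ ^ 2 := by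
    rw [← h2]
    calc _ = ∑ k, ∑ l, ∑ i, ∑ j, A i k * A j l * (G i j * inner ℝ (a k l) w) := by
          refine (Finset.sum_congr rfl fun i _ => Finset.sum_comm).trans
            (Finset.sum_comm.trans (Finset.sum_congr rfl fun k _ => ?_))
          exact (Finset.sum_congr rfl fun i _ => Finset.sum_comm).trans Finset.sum_comm
      _ = _ := by
          refine Finset.sum_congr rfl fun i _ => Finset.sum_congr rfl fun j _ =>
            Finset.sum_congr rfl fun k _ => Finset.sum_congr rfl fun l _ => ?_
          rw [hA k i, hA l j]
  have h4 : ∑ i, ∑ j, ∑ k, ∑ l, A i k * A j l * (G i j * G k l * ‖w‖ ^ 2) = n * ‖w‖ ^ 2 := by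
    have h5 : ∀ i j, ∑ k, ∑ l, A i k * A j l * (G i j * G k l * ‖w‖ ^ 2)
        = A i j * G i j * ‖w‖ ^ 2 := by
      intro i j
      have : ∀ k, ∑ l, A i k * A j l * (G i j * G k l * ‖w‖ ^ 2)
          = A i k * G i j * ‖w‖ ^ 2 * if j = k then 1 else 0 := by
        intro k
        rw [← hδ, Finset.mul_sum]
        exact Finset.sum_congr rfl fun l _ => by ring
      simp [this]
    simp only [h5, ← Finset.sum_mul, hδ]
    simp
  have hexp : ∀ i j k l, A i k * A j l * inner ℝ (a i j - G i j • w) (a k l - G k l • w)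
      = A i k * A j l * inner ℝ (a i j) (a k l) - A i k * A j l * (G k l * inner ℝ (a i j) w)
        - A i k * A j l * (G i j * inner ℝ (a k l) w)
        + A i k * A j l * (G i j * G k l * ‖w‖ ^ 2) := by
    intro i j k l
    simp only [inner_sub_left, inner_sub_right, real_inner_smul_left, real_inner_smul_right,
      real_inner_self_eq_norm_sq, real_inner_comm (a k l) w]
    ring
  simp only [hexp, Finset.sum_add_distrib, Finset.sum_sub_distrib, h2, h3, h4]
  ring

end Trace

namespace Param

variable {n m : ℕ} {F : Euc n → Euc m} {u : Euc n}

namespace IsImmersionNear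

lemma inducedMetric_pos (H : IsImmersionNear F u) {X : Euc n} (hX : X ≠ 0) :
    0 < inducedMetric F u X X :=
  real_inner_self_pos.2 fun h => hX (H.injective (by rw [h, map_zero]))

lemma secondFundamentalForm_eq_of_stdVec (H : IsImmersionNear F u) {w : Euc m}
    (h : ∀ i j, secondFundamentalForm F u (stdVec i) (stdVec j)
      = inducedMetric F u (stdVec i) (stdVec j) • w) (X Y : Euc n) :
    secondFundamentalForm F u X Y = inducedMetric F u X Y • w := by
  rw [← sum_coord_smul_stdVec X, ← sum_coord_smul_stdVec Y, ← H.sff_apply,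
    ← H.isInnerForm.toBilin_apply]
  simp only [map_sum, LinearMap.sum_apply, map_smul, LinearMap.smul_apply, H.sff_apply, h,
    H.isInnerForm.toBilin_apply, Finset.sum_smul, Finset.smul_sum, Finset.mul_sum, smul_smul,
    smul_eq_mul]

/-- The radicand is a positive multiple of the squared norm of `α - ⟨·, ·⟩ H`, so it is positive at a
non-umbilical point; in particular `ρ` is positive and smooth there. -/
lemma rho_radicand_pos (H : IsImmersionNear F u) (hn : 2 ≤ n)
    (hu : ¬ ∀ X Y, secondFundamentalForm F u X Y = inducedMetric F u X Y • meanCurvature F u) :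
    0 < (n : ℝ) / ((n : ℝ) - 1) * (normSqSFF F u - (n : ℝ) * ‖meanCurvature F u‖ ^ 2) := by
  have hn' : (2 : ℝ) ≤ n := by exact_mod_cast hn
  refine mul_pos (div_pos (by linarith) (by linarith)) ?_
  rw [normSqSFF, ← sum_inv_gram_traceFree H.isInnerForm
    (fun i j => secondFundamentalForm F u (stdVec i) (stdVec j))]
  · refine sum_inv_gram_mul_inner_pos H.isInnerForm (fun X hX => H.inducedMetric_pos hX)
      (φ := fun i j => secondFundamentalForm F u (stdVec i) (stdVec j)
        - gram (inducedMetric F u) i j • meanCurvature F u) fun h0 => hu ?_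
    refine H.secondFundamentalForm_eq_of_stdVec fun i j => ?_
    exact sub_eq_zero.1 (congrFun (congrFun h0 i) j)
  · rw [meanCurvature, smul_smul, mul_one_div_cancel (by linarith), one_smul]

lemma contDiffAt_meanCurvature (H : IsImmersionNear F u) :
    ContDiffAt ℝ ∞ (meanCurvature F) u := by
  unfold meanCurvature
  refine contDiffAt_const.fun_smul (ContDiffAt.sum fun i _ => ContDiffAt.sum fun j _ => ?_)
  exact (contDiffAt_inv_apply (A := fun v => gram (inducedMetric F v))
    (fun k l => H.isPullbackNear.contDiffAt_metric _ _) H.isInnerForm.det_ne_zero i j).fun_smul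
    (H.contDiffAt_secondFundamentalForm _ _)

lemma contDiffAt_normSqSFF (H : IsImmersionNear F u) : ContDiffAt ℝ ∞ (normSqSFF F) u := by
  unfold normSqSFF
  refine ContDiffAt.sum fun i _ => ContDiffAt.sum fun j _ => ContDiffAt.sum fun k _ =>
    ContDiffAt.sum fun l _ => ?_
  have hinv := contDiffAt_inv_apply (A := fun v => gram (inducedMetric F v))
    (fun k l => H.isPullbackNear.contDiffAt_metric _ _) H.isInnerForm.det_ne_zero
  exact ((hinv i k).mul (hinv j l)).mul
    ((H.contDiffAt_secondFundamentalForm _ _).inner ℝ (H.contDiffAt_secondFundamentalForm _ _))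

lemma contDiffAt_rho (H : IsImmersionNear F u) (hρ : 0 < rho F u) : ContDiffAt ℝ ∞ (rho F) u := by
  unfold rho
  refine ContDiffAt.sqrt (contDiffAt_const.mul (H.contDiffAt_normSqSFF.sub
    (contDiffAt_const.mul (H.contDiffAt_meanCurvature.norm_sq ℝ)))) (Real.sqrt_pos.1 hρ).ne'

lemma eventually_rho_pos (H : IsImmersionNear F u) (hρ : 0 < rho F u) :
    ∀ᶠ v in 𝓝 u, 0 < rho F v :=
  (H.contDiffAt_rho hρ).continuousAt.eventually (lt_mem_nhds hρ)

end IsImmersionNear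

/-! ### The lift to the light cone -/

/-- The Lorentz inner product on `ℝᵐ × ℝ × ℝ` whose light cone contains the points
`(x, ‖x‖² / 2, 1)`. -/
noncomputable def lorentz (m : ℕ) : (Euc m × ℝ × ℝ) →L[ℝ] (Euc m × ℝ × ℝ) →L[ℝ] ℝ :=
  let s : Euc m →L[ℝ] Euc m →L[ℝ] ℝ := innerSL ℝ
  let p : (Euc m × ℝ × ℝ) →L[ℝ] ℝ := (ContinuousLinearMap.fst ℝ ℝ ℝ).comp
    (ContinuousLinearMap.snd ℝ (Euc m) (ℝ × ℝ))
  let q : (Euc m × ℝ × ℝ) →L[ℝ] ℝ := (ContinuousLinearMap.snd ℝ ℝ ℝ).comp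
    (ContinuousLinearMap.snd ℝ (Euc m) (ℝ × ℝ))
  s.bilinearComp (ContinuousLinearMap.fst ℝ (Euc m) (ℝ × ℝ))
      (ContinuousLinearMap.fst ℝ (Euc m) (ℝ × ℝ))
    - (ContinuousLinearMap.mul ℝ ℝ).bilinearComp p q
    - (ContinuousLinearMap.mul ℝ ℝ).bilinearComp q p

lemma lorentz_apply (x y : Euc m × ℝ × ℝ) :
    lorentz m x y = inner ℝ x.1 y.1 - x.2.1 * y.2.2 - x.2.2 * y.2.1 := rfl

/-- The lift of `F` to the light cone, in the affine section of the cone that is isometric to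
`ℝᵐ`. -/
noncomputable def coneLift (F : Euc n → Euc m) (v : Euc n) : Euc m × ℝ × ℝ :=
  (F v, (1 / 2 : ℝ) * inner ℝ (F v) (F v), 1)

lemma fderiv_coneLift {v : Euc n} (hF : DifferentiableAt ℝ F v) (X : Euc n) :
    fderiv ℝ (coneLift F) v X = (fderiv ℝ F v X, inner ℝ (F v) (fderiv ℝ F v X), 0) := by
  have h2 : DifferentiableAt ℝ (fun v => (1 / 2 : ℝ) * inner ℝ (F v) (F v)) v :=
    (hF.inner ℝ hF).const_mul _
  unfold coneLift
  rw [hF.fderiv_prodMk (h2.prodMk (differentiableAt_const _)),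
    h2.fderiv_prodMk (differentiableAt_const _)]
  simp only [ContinuousLinearMap.prod_apply, fderiv_fun_const, Pi.zero_apply, zero_apply,
    Prod.mk.injEq, true_and, and_true]
  rw [fderiv_const_mul (hF.inner ℝ hF), smul_apply, fderiv_inner_apply ℝ hF hF,
    real_inner_comm (F v)]
  simp only [smul_eq_mul]
  ring

lemma contDiffAt_coneLift {v : Euc n} (hF : ContDiffAt ℝ ∞ F v) :
    ContDiffAt ℝ ∞ (coneLift F) v :=
  hF.prodMk ((contDiffAt_const.mul (hF.inner ℝ hF)).prodMk contDiffAt_const)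

lemma sndDeriv_coneLift (hF : ∀ᶠ v in 𝓝 u, ContDiffAt ℝ ∞ F v) (X Y : Euc n) :
    sndDeriv (coneLift F) u X Y
      = (sndDeriv F u X Y, inner ℝ (F u) (sndDeriv F u X Y) + inducedMetric F u X Y, 0) := by
  have h1 : (fun v => fderiv ℝ (coneLift F) v Y)
      =ᶠ[𝓝 u] fun v => (fderiv ℝ F v Y, inner ℝ (F v) (fderiv ℝ F v Y), (0 : ℝ)) := by
    filter_upwards [hF] with v hv
    exact fderiv_coneLift (hv.differentiableAt (by simp)) Y
  have hu := hF.self_of_nhds.differentiableAt (n := ∞) (by simp)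
  have hY := (contDiffAt_fderiv_apply hF.self_of_nhds Y).differentiableAt (n := ∞) (by simp)
  rw [sndDeriv, h1.fderiv_eq,
    hY.fderiv_prodMk ((hu.inner ℝ hY).prodMk (differentiableAt_const _)),
    (hu.inner ℝ hY).fderiv_prodMk (differentiableAt_const _)]
  simp only [ContinuousLinearMap.prod_apply, fderiv_fun_const, Pi.zero_apply, zero_apply]
  rw [fderiv_inner_apply ℝ hu hY]
  rfl

/-- The lift of `F` to the light cone that induces the Moebius metric. -/
noncomputable def moebiusLift (F : Euc n → Euc m) (v : Euc n) : Euc m × ℝ × ℝ :=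
  rho F v • coneLift F v

lemma fderiv_fun_smul_apply {E' : Type*} [NormedAddCommGroup E'] [NormedSpace ℝ E'] {c : Euc n → ℝ}
    {f : Euc n → E'} {v : Euc n} (hc : DifferentiableAt ℝ c v) (hf : DifferentiableAt ℝ f v)
    (X : Euc n) :
    fderiv ℝ (fun w => c w • f w) v X = c v • fderiv ℝ f v X + fderiv ℝ c v X • f v := by
  rw [fderiv_fun_smul hc hf]
  simp

namespace IsImmersionNear

lemma fderiv_moebiusLift (H : IsImmersionNear F u) (hρ : 0 < rho F u) (X : Euc n) :
    fderiv ℝ (moebiusLift F) u X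
      = rho F u • fderiv ℝ (coneLift F) u X + fderiv ℝ (rho F) u X • coneLift F u :=
  fderiv_fun_smul_apply ((H.contDiffAt_rho hρ).differentiableAt (by simp))
    ((contDiffAt_coneLift H.smooth.self_of_nhds).differentiableAt (by simp)) X

lemma sndDeriv_moebiusLift (H : IsImmersionNear F u) (hρ : 0 < rho F u) (X Y : Euc n) :
    sndDeriv (moebiusLift F) u X Y
      = rho F u • sndDeriv (coneLift F) u X Y + fderiv ℝ (rho F) u X • fderiv ℝ (coneLift F) u Y
        + fderiv ℝ (rho F) u Y • fderiv ℝ (coneLift F) u X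
        + sndDeriv (rho F) u X Y • coneLift F u := by
  have h1 : (fun v => fderiv ℝ (moebiusLift F) v Y) =ᶠ[𝓝 u] fun v =>
      rho F v • fderiv ℝ (coneLift F) v Y + fderiv ℝ (rho F) v Y • coneLift F v := by
    filter_upwards [H.eventually, H.eventually_rho_pos hρ] with v hv hv'
    exact hv.fderiv_moebiusLift hv' Y
  have hr := H.contDiffAt_rho hρ
  have hc := contDiffAt_coneLift H.smooth.self_of_nhds
  have hr1 := hr.differentiableAt (n := ∞) (by simp)
  have hc1 := hc.differentiableAt (n := ∞) (by simp)
  have hr2 := (contDiffAt_fderiv_apply hr Y).differentiableAt (n := ∞) (by simp)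
  have hc2 := (contDiffAt_fderiv_apply hc Y).differentiableAt (n := ∞) (by simp)
  rw [sndDeriv, h1.fderiv_eq, fderiv_fun_add (hr1.fun_smul hc2) (hr2.fun_smul hc1), add_apply,
    fderiv_fun_smul_apply hr1 hc2, fderiv_fun_smul_apply hr2 hc1, ← add_assoc]
  rfl

/-- The Moebius metric is induced by the lift to the light cone. -/
lemma isPullbackNear_moebius (H : IsImmersionNear F u) (hρ : 0 < rho F u) :
    IsPullbackNear (moebiusMetric F) (lorentz m) (moebiusLift F) u where
  symm x y := by
    rw [lorentz_apply, lorentz_apply, real_inner_comm]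
    ring
  smooth := by
    filter_upwards [H.eventually, H.eventually_rho_pos hρ] with v hv hv'
    exact (hv.contDiffAt_rho hv').smul (contDiffAt_coneLift hv.smooth.self_of_nhds)
  eq := by
    filter_upwards [H.eventually, H.eventually_rho_pos hρ] with v hv hv' X Y
    have hd := hv.smooth.self_of_nhds.differentiableAt (n := ∞) (by simp)
    rw [hv.fderiv_moebiusLift hv', hv.fderiv_moebiusLift hv', fderiv_coneLift hd,
      fderiv_coneLift hd, lorentz_apply, moebiusMetric, inducedMetric, coneLift]
    simp [inner_add_left, inner_add_right, inner_smul_left, inner_smul_right,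
      real_inner_comm (F v)]
    ring
  det_ne_zero := by
    have : gram (moebiusMetric F u) = rho F u ^ 2 • gram (inducedMetric F u) := rfl
    rw [this, Matrix.det_smul]
    exact mul_ne_zero (by positivity) H.isInnerForm.det_ne_zero

end IsImmersionNear

end Param

/-! ### The Gauss equation of the Moebius metric -/

namespace Param

variable {n m : ℕ} {F : Euc n → Euc m} {u : Euc n}

/-- The component in `ℝᵐ` of the second fundamental form of the lift to the light cone, with
respect to the frame that moves with the point of the cone. -/
noncomputable def liftPart (F : Euc n → Euc m) (u X Y : Euc n) : Euc m :=
  rho F u • sndDeriv F u X Y + fderiv ℝ (rho F) u X • fderiv ℝ F u Y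
    + fderiv ℝ (rho F) u Y • fderiv ℝ F u X
    - rho F u • fderiv ℝ F u (christoffel (moebiusMetric F) u X Y)

namespace IsImmersionNear

lemma sndDeriv_moebiusLift_sub (H : IsImmersionNear F u) (hρ : 0 < rho F u) (X Y : Euc n) :
    sndDeriv (moebiusLift F) u X Y
        - fderiv ℝ (moebiusLift F) u (christoffel (moebiusMetric F) u X Y)
      = hess (moebiusMetric F) (rho F) u X Y • coneLift F u
        + (liftPart F u X Y,
            inner ℝ (F u) (liftPart F u X Y) + rho F u * inducedMetric F u X Y, (0 : ℝ)) := by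
  have hd := H.smooth.self_of_nhds.differentiableAt (n := ∞) (by simp)
  have hh : sndDeriv (rho F) u X Y = hess (moebiusMetric F) (rho F) u X Y
      + fderiv ℝ (rho F) u (christoffel (moebiusMetric F) u X Y) := by
    simp [hess, sndDeriv]
  rw [H.sndDeriv_moebiusLift hρ, H.fderiv_moebiusLift hρ, sndDeriv_coneLift H.smooth,
    fderiv_coneLift hd, fderiv_coneLift hd, fderiv_coneLift hd, hh]
  refine Prod.ext ?_ (Prod.ext ?_ ?_)
  · simp only [coneLift, liftPart, Prod.fst_add, Prod.fst_sub, Prod.smul_fst]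
    module
  · simp only [coneLift, liftPart, Prod.fst_add, Prod.fst_sub, Prod.smul_fst, Prod.snd_add,
      Prod.snd_sub, Prod.smul_snd, inner_add_right, inner_sub_right, real_inner_smul_right,
      smul_eq_mul]
    ring
  · simp only [coneLift, Prod.snd_add, Prod.snd_sub, Prod.smul_snd, smul_eq_mul]
    ring

lemma inner_liftPart_fderiv (H : IsImmersionNear F u) (hρ : 0 < rho F u) (X Y Z : Euc n) :
    inner ℝ (liftPart F u X Y) (fderiv ℝ F u Z)
      = inducedMetric F u X Y * fderiv ℝ (rho F) u Z := by
  have h := (H.isPullbackNear_moebius hρ).sndDeriv_sub_orthogonal X Y Z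
  rw [H.sndDeriv_moebiusLift_sub hρ, H.fderiv_moebiusLift hρ,
    fderiv_coneLift (H.smooth.self_of_nhds.differentiableAt (n := ∞) (by simp)),
    lorentz_apply] at h
  simp only [coneLift, Prod.fst_add, Prod.smul_fst, Prod.snd_add, Prod.smul_snd, inner_add_left,
    inner_add_right, real_inner_smul_left, real_inner_smul_right, smul_eq_mul,
    real_inner_comm (F u) (liftPart F u X Y)] at h
  refine mul_left_cancel₀ hρ.ne' ?_
  linarith

lemma moebiusMetric_grad (H : IsImmersionNear F u) (hρ : 0 < rho F u) (Z : Euc n) :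
    moebiusMetric F u (grad (moebiusMetric F) (rho F) u) Z = fderiv ℝ (rho F) u Z :=
  (H.isPullbackNear_moebius hρ).isInnerForm.apply_sharp
    (φ := fun Z => fderiv ℝ (rho F) u Z) (fderiv ℝ (rho F) u).toLinearMap.isLinear Z

/-- The normal component of `liftPart` is `ρ α` and its tangential component is a multiple of the
gradient of `ρ`. -/
lemma liftPart_eq (H : IsImmersionNear F u) (hρ : 0 < rho F u) (X Y : Euc n) :
    liftPart F u X Y = rho F u • secondFundamentalForm F u X Y
      + (inducedMetric F u X Y * rho F u ^ 2) •
          fderiv ℝ F u (grad (moebiusMetric F) (rho F) u) := by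
  -- the difference of both sides is a normal vector whose normal projection vanishes
  set w := liftPart F u X Y - rho F u • secondFundamentalForm F u X Y
      - (inducedMetric F u X Y * rho F u ^ 2) •
          fderiv ℝ F u (grad (moebiusMetric F) (rho F) u) with hw
  have h1 : w ∈ normalSpace F u := by
    rintro _ ⟨Z, rfl⟩
    change inner ℝ (fderiv ℝ F u Z) w = 0
    have hg := H.moebiusMetric_grad hρ Z
    rw [moebiusMetric, inducedMetric] at hg
    rw [real_inner_comm, hw, inner_sub_left, inner_sub_left, H.inner_liftPart_fderiv hρ,
      real_inner_smul_left, real_inner_smul_left,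
      inner_fderiv_of_mem_normalSpace (secondFundamentalForm_mem X Y), ← hg]
    ring
  have h2 : normalProj F u w = 0 := by
    rw [hw, map_sub, map_sub, map_smul, map_smul, normalProj_fderiv,
      normalProj_of_mem (secondFundamentalForm_mem X Y), liftPart]
    simp only [map_add, map_sub, map_smul, normalProj_fderiv]
    simp [secondFundamentalForm, sndDeriv]
  rw [normalProj_of_mem h1] at h2
  rw [hw, sub_sub, sub_eq_zero] at h2
  exact h2

/-- The products of the values of the second fundamental form of the lift to the light cone, in terms
of the Moebius second fundamental form and the Blaschke tensor. -/
lemma lorentz_sff (H : IsImmersionNear F u) (hρ : 0 < rho F u) (X Y Z W : Euc n) :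
    lorentz m
        (sndDeriv (moebiusLift F) u X Y
          - fderiv ℝ (moebiusLift F) u (christoffel (moebiusMetric F) u X Y))
        (sndDeriv (moebiusLift F) u Z W
          - fderiv ℝ (moebiusLift F) u (christoffel (moebiusMetric F) u Z W))
      = inner ℝ (beta F u X Y) (beta F u Z W)
        + blaschke F u X Y * moebiusMetric F u Z W
        + blaschke F u Z W * moebiusMetric F u X Y := by
  have hT : inner ℝ (liftPart F u X Y) (liftPart F u Z W)
      = rho F u ^ 2 * inner ℝ (secondFundamentalForm F u X Y) (secondFundamentalForm F u Z W)
        + inducedMetric F u X Y * inducedMetric F u Z W * rho F u ^ 2 *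
          moebiusMetric F u (grad (moebiusMetric F) (rho F) u)
            (grad (moebiusMetric F) (rho F) u) := by
    rw [H.liftPart_eq hρ, H.liftPart_eq hρ]
    simp only [inner_add_left, inner_add_right, real_inner_smul_left, real_inner_smul_right]
    rw [inner_fderiv_of_mem_normalSpace (secondFundamentalForm_mem X Y),
      real_inner_comm (secondFundamentalForm F u Z W)
        (fderiv ℝ F u (grad (moebiusMetric F) (rho F) u)),
      inner_fderiv_of_mem_normalSpace (secondFundamentalForm_mem Z W), moebiusMetric]
    conv_rhs => enter [2, 2, 2]; rw [inducedMetric]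
    ring
  have hS : lorentz m
        (sndDeriv (moebiusLift F) u X Y
          - fderiv ℝ (moebiusLift F) u (christoffel (moebiusMetric F) u X Y))
        (sndDeriv (moebiusLift F) u Z W
          - fderiv ℝ (moebiusLift F) u (christoffel (moebiusMetric F) u Z W))
      = inner ℝ (liftPart F u X Y) (liftPart F u Z W)
        - rho F u * inducedMetric F u Z W * hess (moebiusMetric F) (rho F) u X Y
        - rho F u * inducedMetric F u X Y * hess (moebiusMetric F) (rho F) u Z W := by
    rw [H.sndDeriv_moebiusLift_sub hρ, H.sndDeriv_moebiusLift_sub hρ, lorentz_apply]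
    simp only [coneLift, Prod.fst_add, Prod.smul_fst, Prod.snd_add, Prod.smul_snd, inner_add_left,
      inner_add_right, real_inner_smul_left, real_inner_smul_right, smul_eq_mul,
      real_inner_comm (F u) (liftPart F u X Y)]
    ring
  rw [hS, hT]
  have hr := hρ.ne'
  simp only [blaschke, beta, inner_sub_left, inner_sub_right, real_inner_smul_left,
    real_inner_smul_right, real_inner_self_eq_norm_sq,
    real_inner_comm (secondFundamentalForm F u Z W) (meanCurvature F u)]
  generalize moebiusMetric F u (grad (moebiusMetric F) (rho F) u)
    (grad (moebiusMetric F) (rho F) u) = a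
  simp only [moebiusMetric]
  field_simp
  ring

/-- The Gauss equation for the Moebius metric, in terms of the Moebius second fundamental form and
the Blaschke tensor. -/
theorem moebius_gauss_equation (H : IsImmersionNear F u) (hρ : 0 < rho F u) (X Y Z W : Euc n) :
    moebiusMetric F u (curvature (moebiusMetric F) u X Y Z) W
      = inner ℝ (beta F u Y Z) (beta F u X W) - inner ℝ (beta F u X Z) (beta F u Y W)
        + blaschke F u Y Z * moebiusMetric F u X W + blaschke F u X W * moebiusMetric F u Y Z
        - blaschke F u X Z * moebiusMetric F u Y W - blaschke F u Y W * moebiusMetric F u X Z := by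
  rw [(H.isPullbackNear_moebius hρ).gauss_equation, H.lorentz_sff hρ, H.lorentz_sff hρ]
  ring

end IsImmersionNear

end Param

/-! ### Linear algebra of a diagonalized curvature condition -/

section LinearAlgebra

variable {V : Type*} [AddCommGroup V] [Module ℝ V]

/-- Commuting operators that are symmetric with respect to a positive definite form `b` are
simultaneously diagonalizable. -/
lemma iSup_iInf_eigenspace_eq_top [FiniteDimensional ℝ V] {b : V →ₗ[ℝ] V →ₗ[ℝ] ℝ}
    (hs : ∀ X Y, b X Y = b Y X) (hpos : ∀ X, X ≠ 0 → 0 < b X X) {ι : Type*} {T : ι → V →ₗ[ℝ] V}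
    (hT : ∀ i X Y, b (T i X) Y = b X (T i Y)) (hc : ∀ i j X, T i (T j X) = T j (T i X)) :
    ⨆ χ : ι → ℝ, ⨅ i, Module.End.eigenspace (T i) (χ i) = ⊤ := by
  let c : InnerProductSpace.Core ℝ V :=
    { inner := fun X Y => b X Y
      conj_inner_symm := fun X Y => hs Y X
      re_inner_nonneg := fun X => by
        rcases eq_or_ne X 0 with rfl | h
        · simp
        · exact (hpos X h).le
      add_left := fun X Y Z => by simp
      smul_left := fun X Y r => by simp
      definite := fun X h => by
        by_contra hX
        exact (hpos X hX).ne' h }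
  let _ : NormedAddCommGroup V := c.toNormedAddCommGroup
  let _ : InnerProductSpace ℝ V := InnerProductSpace.ofCore c.toCore
  exact LinearMap.IsSymmetric.iSup_iInf_eq_top_of_commute (fun i X Y => hT i X Y)
    fun i j _ => LinearMap.ext fun X => hc i j X

/-- The algebraic data of a point: an inner product `h`, a symmetric vector valued form `β` that is
diagonalized by the subspaces `E i` with values `ν i`, a symmetric form `ψ`, and a curvature-like
tensor `R` that is expressed by `h`, `β` and `ψ`. -/
structure DiagonalizedGauss {W ι : Type*} [NormedAddCommGroup W] [InnerProductSpace ℝ W]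
    (h : V →ₗ[ℝ] V →ₗ[ℝ] ℝ) (β : V →ₗ[ℝ] V →ₗ[ℝ] W) (ψ : V →ₗ[ℝ] V →ₗ[ℝ] ℝ)
    (R : V → V → V → V) (E : ι → Submodule ℝ V) (ν : ι → W) : Prop where
  h_symm : ∀ X Y, h X Y = h Y X
  h_pos : ∀ X, X ≠ 0 → 0 < h X X
  β_symm : ∀ X Y, β X Y = β Y X
  ψ_symm : ∀ X Y, ψ X Y = ψ Y X
  gauss : ∀ X Y Z U, h (R X Y Z) U
    = inner ℝ (β Y Z) (β X U) - inner ℝ (β X Z) (β Y U) + ψ Y Z * h X U + ψ X U * h Y Z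
      - ψ X Z * h Y U - ψ Y U * h X Z
  β_eq : ∀ i, ∀ X ∈ E i, ∀ Y, β X Y = h X Y • ν i
  ν_injective : Function.Injective ν
  iSup_E : ⨆ i, E i = ⊤
  exists_ne_zero : ∀ i, ∃ X ∈ E i, X ≠ 0
  E_ne_top : ∀ i, E i ≠ ⊤

namespace DiagonalizedGauss

variable {W ι : Type*} [NormedAddCommGroup W] [InnerProductSpace ℝ W]
  {h : V →ₗ[ℝ] V →ₗ[ℝ] ℝ} {β : V →ₗ[ℝ] V →ₗ[ℝ] W} {ψ : V →ₗ[ℝ] V →ₗ[ℝ] ℝ}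
  {R : V → V → V → V} {E : ι → Submodule ℝ V} {ν : ι → W}

lemma orthogonal (D : DiagonalizedGauss h β ψ R E ν) {i j : ι} (hij : i ≠ j) {Z U : V}
    (hZ : Z ∈ E i) (hU : U ∈ E j) : h Z U = 0 := by
  have h1 := D.β_eq i Z hZ U
  rw [D.β_symm, D.β_eq j U hU, D.h_symm U Z, ← sub_eq_zero, ← smul_sub, smul_eq_zero] at h1
  exact h1.resolve_right (sub_ne_zero.2 fun e => hij (D.ν_injective e).symm)

lemma exists_ne (D : DiagonalizedGauss h β ψ R E ν) (i : ι) : ∃ j, j ≠ i := by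
  by_contra! hall
  apply D.E_ne_top i
  rw [eq_top_iff, ← D.iSup_E]
  exact iSup_le fun j => by rw [hall j]

lemma eq_of_forall (D : DiagonalizedGauss h β ψ R E ν) {X Y : V} (hXY : ∀ U, h X U = h Y U) :
    X = Y := by
  by_contra hne
  have := D.h_pos (X - Y) (sub_ne_zero.2 hne)
  simp only [map_sub, LinearMap.sub_apply, hXY] at this
  simp at this

lemma map_add (D : DiagonalizedGauss h β ψ R E ν) (X Y Z U : V) :
    R X Y (Z + U) = R X Y Z + R X Y U := by
  refine D.eq_of_forall fun A => ?_
  simp only [_root_.map_add, LinearMap.add_apply, D.gauss, inner_add_left]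
  ring

lemma map_zero (D : DiagonalizedGauss h β ψ R E ν) (X Y : V) : R X Y 0 = 0 := by
  simpa using D.map_add X Y 0 0

lemma gauss_antisymm (D : DiagonalizedGauss h β ψ R E ν) (X Y Z U : V) :
    h (R X Y U) Z = -h (R X Y Z) U := by
  rw [D.gauss, D.gauss, real_inner_comm (β X Z) (β Y U), real_inner_comm (β Y Z)]
  ring

/-- On the product of two summands the action of the curvature on `β` is a multiple of the
difference of the two values of `β`. -/
lemma act_eq (D : DiagonalizedGauss h β ψ R E ν) (X Y : V) {i j : ι} {Z U : V} (hZ : Z ∈ E i)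
    (hU : U ∈ E j) :
    β (R X Y Z) U + β Z (R X Y U) = h (R X Y Z) U • (ν j - ν i) := by
  rw [D.β_symm _ U, D.β_eq j U hU, D.β_eq i Z hZ, D.h_symm U, D.h_symm Z, D.gauss_antisymm X Y Z U]
  module

lemma apply_eq (D : DiagonalizedGauss h β ψ R E ν) (X Y : V) {i j : ι} {Z U : V} (hZ : Z ∈ E i)
    (hU : U ∈ E j) :
    h (R X Y Z) U = (h Y Z * h X U - h X Z * h Y U) * inner ℝ (ν i) (ν j)
      + ψ Y Z * h X U + ψ X U * h Y Z - ψ X Z * h Y U - ψ Y U * h X Z := by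
  rw [D.gauss, D.β_symm Y Z, D.β_symm X U, D.β_symm X Z, D.β_symm Y U, D.β_eq i Z hZ, D.β_eq i Z hZ,
    D.β_eq j U hU, D.β_eq j U hU]
  simp only [real_inner_smul_left, real_inner_smul_right, D.h_symm Z, D.h_symm U]
  ring

/-- `R · β = 0` if and only if `R X Y` maps each summand to the orthogonal complement of the other
summands. -/
lemma act_eq_zero_iff (D : DiagonalizedGauss h β ψ R E ν) :
    (∀ X Y Z U, β (R X Y Z) U + β Z (R X Y U) = 0) ↔
      ∀ i j, i ≠ j → ∀ Z ∈ E i, ∀ U ∈ E j, ∀ X Y, h (R X Y Z) U = 0 := by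
  constructor
  · intro H i j hij Z hZ U hU X Y
    have := H X Y Z U
    rw [D.act_eq X Y hZ hU, smul_eq_zero] at this
    exact this.resolve_right (sub_ne_zero.2 fun e => hij (D.ν_injective e).symm)
  · intro H X Y Z U
    have hZ : Z ∈ ⨆ i, E i := D.iSup_E ▸ Submodule.mem_top
    have hU : U ∈ ⨆ i, E i := D.iSup_E ▸ Submodule.mem_top
    refine Submodule.iSup_induction E (motive := fun Z => β (R X Y Z) U + β Z (R X Y U) = 0) hZ
      (fun i Z hZ => ?_) (by simp [D.map_zero]) fun Z Z' h1 h2 => ?_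
    · refine Submodule.iSup_induction E (motive := fun U => β (R X Y Z) U + β Z (R X Y U) = 0) hU
        (fun j U hU => ?_) (by simp [D.map_zero]) fun U U' h1 h2 => ?_
      · rw [D.act_eq X Y hZ hU]
        rcases eq_or_ne i j with rfl | hij
        · rw [sub_self, smul_zero]
        · rw [H i j hij Z hZ U hU, zero_smul]
      · rw [D.map_add, _root_.map_add, _root_.map_add, add_add_add_comm, h1, h2, add_zero]
    · rw [D.map_add, _root_.map_add, _root_.map_add, LinearMap.add_apply, LinearMap.add_apply,
        add_add_add_comm, h1, h2, add_zero]

/-- In dimension at least three, two vectors of different summands have a common nonzero orthogonal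
vector in some summand. -/
lemma exists_orthogonal (D : DiagonalizedGauss h β ψ R E ν) (hdim : 3 ≤ Module.finrank ℝ V)
    {i j : ι} (hij : i ≠ j) {Z U : V} (hZ : Z ∈ E i) (hU : U ∈ E j) (hZ0 : Z ≠ 0) (hU0 : U ≠ 0) :
    ∃ l, ∃ A ∈ E l, A ≠ 0 ∧ h A Z = 0 ∧ h A U = 0 := by
  by_contra! hno
  have hZZ := (D.h_pos Z hZ0).ne'
  have hUU := (D.h_pos U hU0).ne'
  have hle : ∀ l, E l ≤ Submodule.span ℝ {Z, U} := by
    intro l A hA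
    -- the component of `A` orthogonal to `Z` and `U` lies in the same summand as `A`
    rcases eq_or_ne l i with rfl | hli
    · have hm : A - (h A Z / h Z Z) • Z ∈ E l := (E l).sub_mem hA ((E l).smul_mem _ hZ)
      by_cases h0 : A - (h A Z / h Z Z) • Z = 0
      · rw [sub_eq_zero] at h0
        rw [h0]
        exact Submodule.smul_mem _ _ (Submodule.subset_span (by simp))
      · refine absurd (D.orthogonal hij hm hU) (hno l _ hm h0 ?_)
        simp only [map_sub, map_smul, LinearMap.sub_apply, LinearMap.smul_apply, smul_eq_mul]
        field_simp
        ring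
    rcases eq_or_ne l j with rfl | hlj
    · have hm : A - (h A U / h U U) • U ∈ E l := (E l).sub_mem hA ((E l).smul_mem _ hU)
      by_cases h0 : A - (h A U / h U U) • U = 0
      · rw [sub_eq_zero] at h0
        rw [h0]
        exact Submodule.smul_mem _ _ (Submodule.subset_span (by simp))
      · refine absurd ?_ (hno l _ hm h0 (D.orthogonal hli hm hZ))
        simp only [map_sub, map_smul, LinearMap.sub_apply, LinearMap.smul_apply, smul_eq_mul]
        field_simp
        ring
    · by_cases h0 : A = 0
      · rw [h0]; exact Submodule.zero_mem _
      · exact absurd (D.orthogonal hlj hA hU) (hno l A hA h0 (D.orthogonal hli hA hZ))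
  have htop : Submodule.span ℝ ({Z, U} : Set V) = ⊤ := by
    rw [eq_top_iff, ← D.iSup_E]; exact iSup_le hle
  classical
  have hc : Module.finrank ℝ (Submodule.span ℝ ((({Z, U} : Finset V)) : Set V)) ≤ 2 :=
    (finrank_span_finset_le_card _).trans Finset.card_le_two
  rw [Finset.coe_pair, htop, finrank_top] at hc
  omega

/-- The algebraic core: `R · β = 0` if and only if each summand consists of eigenvectors of `ψ` and
the eigenvalues satisfy the stated relation. -/
theorem act_eq_zero_iff_exists (D : DiagonalizedGauss h β ψ R E ν)
    (hdim : 3 ≤ Module.finrank ℝ V) :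
    (∀ X Y Z U, β (R X Y Z) U + β Z (R X Y U) = 0) ↔
      ∃ θ : ι → ℝ, (∀ i, ∀ X ∈ E i, ∀ Y, ψ X Y = θ i * h X Y) ∧
        ∀ i j, i ≠ j → inner ℝ (ν i) (ν j) + θ i + θ j = 0 := by
  rw [D.act_eq_zero_iff]
  constructor
  · intro H
    have key : ∀ {i j : ι}, i ≠ j → ∀ {Z U : V}, Z ∈ E i → U ∈ E j → ∀ X,
        h Z Z * h X U * inner ℝ (ν i) (ν j) + ψ Z Z * h X U + ψ X U * h Z Z - ψ Z U * h X Z = 0 := by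
      intro i j hij Z U hZ hU X
      have h1 := H i j hij Z hZ U hU X Z
      rw [D.apply_eq X Z hZ hU, D.orthogonal hij hZ hU] at h1
      linarith
    have key' : ∀ {i j : ι}, i ≠ j → ∀ {Z U : V}, Z ∈ E i → U ∈ E j → Z ≠ 0 → ∀ X,
        h X Z = 0 → h X U = 0 → ψ X U = 0 := by
      intro i j hij Z U hZ hU hZ0 X hXZ hXU
      have h1 := key hij hZ hU X
      rw [hXZ, hXU] at h1
      have h2 := (D.h_pos Z hZ0).ne'
      simpa [h2] using h1
    -- off-diagonal vanishing: replace one of the two vectors by a third one orthogonal to both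
    have hoff : ∀ {i j : ι}, i ≠ j → ∀ {Z U : V}, Z ∈ E i → U ∈ E j → Z ≠ 0 → U ≠ 0 →
        ψ Z U = 0 := by
      intro i j hij Z U hZ hU hZ0 hU0
      obtain ⟨l, A, hA, hA0, hAZ, hAU⟩ := D.exists_orthogonal hdim hij hZ hU hZ0 hU0
      rcases eq_or_ne l j with rfl | hlj
      · rw [D.ψ_symm]
        exact key' hij.symm hA hZ hA0 U (by rw [D.h_symm, hAU])
          (by rw [D.h_symm, D.orthogonal hij hZ hU])
      · exact key' hlj hA hU hA0 Z (by rw [D.h_symm, hAZ]) (D.orthogonal hij hZ hU)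
    choose e he he0 using D.exists_ne_zero
    have hee : ∀ i, h (e i) (e i) ≠ 0 := fun i => (D.h_pos _ (he0 i)).ne'
    have hrel : ∀ i j, i ≠ j → inner ℝ (ν i) (ν j) + ψ (e i) (e i) / h (e i) (e i)
        + ψ (e j) (e j) / h (e j) (e j) = 0 := by
      intro i j hij
      have h1 := key hij (he i) (he j) (e j)
      rw [hoff hij (he i) (he j) (he0 i) (he0 j)] at h1
      have hi := hee i
      have hj := hee j
      field_simp
      linarith
    refine ⟨fun i => ψ (e i) (e i) / h (e i) (e i), fun j U hU X => ?_, hrel⟩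
    rcases eq_or_ne U 0 with rfl | hU0
    · simp
    obtain ⟨i, hij⟩ := D.exists_ne j
    have h1 := key hij (he i) hU X
    rw [hoff hij (he i) hU (he0 i) hU0] at h1
    have h2 : ψ (e j) (e j) / h (e j) (e j)
        = -(inner ℝ (ν i) (ν j) + ψ (e i) (e i) / h (e i) (e i)) := by linarith [hrel i j hij]
    have hi := hee i
    beta_reduce
    rw [h2, D.ψ_symm, D.h_symm U]
    field_simp
    linarith
  · rintro ⟨θ, h1, h2⟩ i j hij Z hZ U hU X Y
    rw [D.apply_eq X Y hZ hU, D.ψ_symm Y Z, D.ψ_symm X U, D.ψ_symm X Z, D.ψ_symm Y U, h1 i Z hZ,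
      h1 i Z hZ, h1 j U hU, h1 j U hU, D.h_symm Z, D.h_symm Z, D.h_symm U, D.h_symm U]
    linear_combination (h Y Z * h X U - h X Z * h Y U) * h2 i j hij

end DiagonalizedGauss

end LinearAlgebra

/-! ### The pointwise characterization -/

namespace IsPullbackNear

variable {n : ℕ} {E : Type*} [NormedAddCommGroup E] [NormedSpace ℝ E]
  {h : Euc n → Euc n → Euc n → ℝ} {B : E →L[ℝ] E →L[ℝ] ℝ} {Ψ : Euc n → E} {u : Euc n}

lemma christoffel_comm (H : IsPullbackNear h B Ψ u) (X Y : Euc n) :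
    christoffel h u X Y = christoffel h u Y X :=
  H.isInnerForm.ext_right fun Z => by
    rw [H.apply_christoffel, H.apply_christoffel, sndDeriv_comm H.smooth.self_of_nhds]

lemma christoffel_add_right (H : IsPullbackNear h B Ψ u) (X Y Z : Euc n) :
    christoffel h u X (Y + Z) = christoffel h u X Y + christoffel h u X Z :=
  H.isInnerForm.ext_right fun W => by
    rw [H.isInnerForm.add_left, H.apply_christoffel, H.apply_christoffel, H.apply_christoffel,
      sndDeriv_add_right H.smooth.self_of_nhds, map_add, add_apply]

lemma christoffel_smul_right (H : IsPullbackNear h B Ψ u) (c : ℝ) (X Y : Euc n) :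
    christoffel h u X (c • Y) = c • christoffel h u X Y :=
  H.isInnerForm.ext_right fun W => by
    rw [H.isInnerForm.smul_left, H.apply_christoffel, H.apply_christoffel,
      sndDeriv_smul_right H.smooth.self_of_nhds, map_smul, smul_apply, smul_eq_mul]

lemma hess_eq (r : Euc n → ℝ) (X Y : Euc n) :
    hess h r u X Y = sndDeriv r u X Y - fderiv ℝ r u (christoffel h u X Y) := rfl

variable {r : Euc n → ℝ}

lemma hess_comm (H : IsPullbackNear h B Ψ u) (hr : ContDiffAt ℝ ∞ r u) (X Y : Euc n) :
    hess h r u X Y = hess h r u Y X := by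
  rw [hess_eq, hess_eq, H.christoffel_comm, sndDeriv_comm hr]

lemma hess_add_right (H : IsPullbackNear h B Ψ u) (hr : ContDiffAt ℝ ∞ r u) (X Y Z : Euc n) :
    hess h r u X (Y + Z) = hess h r u X Y + hess h r u X Z := by
  rw [hess_eq, hess_eq, hess_eq, H.christoffel_add_right, sndDeriv_add_right hr, map_add]
  ring

lemma hess_smul_right (H : IsPullbackNear h B Ψ u) (hr : ContDiffAt ℝ ∞ r u) (c : ℝ)
    (X Y : Euc n) : hess h r u X (c • Y) = c * hess h r u X Y := by
  rw [hess_eq, hess_eq, H.christoffel_smul_right, sndDeriv_smul_right hr, map_smul, smul_eq_mul,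
    smul_eq_mul]
  ring

end IsPullbackNear

namespace Param

variable {n m : ℕ} {F : Euc n → Euc m} {u : Euc n}

namespace IsImmersionNear

lemma beta_comm (H : IsImmersionNear F u) (X Y : Euc n) : beta F u X Y = beta F u Y X := by
  rw [beta, beta, H.secondFundamentalForm_comm, H.isInnerForm.symm]

lemma beta_add_right (H : IsImmersionNear F u) (X Y Z : Euc n) :
    beta F u X (Y + Z) = beta F u X Y + beta F u X Z := by
  rw [beta, beta, beta, H.secondFundamentalForm_add_right, H.isInnerForm.add_right]
  module

lemma beta_smul_right (H : IsImmersionNear F u) (c : ℝ) (X Y : Euc n) :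
    beta F u X (c • Y) = c • beta F u X Y := by
  rw [beta, beta, H.secondFundamentalForm_smul_right, H.isInnerForm.smul_right]
  module

/-- The Moebius second fundamental form as a bundled bilinear map. -/
noncomputable def betaBilin (H : IsImmersionNear F u) : Euc n →ₗ[ℝ] Euc n →ₗ[ℝ] Euc m :=
  LinearMap.mk₂ ℝ (beta F u)
    (fun X Y Z => by rw [H.beta_comm, H.beta_add_right, H.beta_comm Z, H.beta_comm Z])
    (fun c X Z => by rw [H.beta_comm, H.beta_smul_right, H.beta_comm Z])
    H.beta_add_right H.beta_smul_right

lemma blaschke_comm (H : IsImmersionNear F u) (hρ : 0 < rho F u) (X Y : Euc n) :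
    blaschke F u X Y = blaschke F u Y X := by
  rw [blaschke, blaschke, H.beta_comm, (H.isPullbackNear_moebius hρ).isInnerForm.symm X,
    (H.isPullbackNear_moebius hρ).hess_comm (H.contDiffAt_rho hρ)]

lemma blaschke_add_right (H : IsImmersionNear F u) (hρ : 0 < rho F u) (X Y Z : Euc n) :
    blaschke F u X (Y + Z) = blaschke F u X Y + blaschke F u X Z := by
  simp only [blaschke, H.beta_add_right, (H.isPullbackNear_moebius hρ).isInnerForm.add_right X,
    (H.isPullbackNear_moebius hρ).hess_add_right (H.contDiffAt_rho hρ), inner_add_left]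
  ring

lemma blaschke_smul_right (H : IsImmersionNear F u) (hρ : 0 < rho F u) (c : ℝ) (X Y : Euc n) :
    blaschke F u X (c • Y) = c • blaschke F u X Y := by
  simp only [blaschke, H.beta_smul_right, (H.isPullbackNear_moebius hρ).isInnerForm.smul_right c X,
    (H.isPullbackNear_moebius hρ).hess_smul_right (H.contDiffAt_rho hρ), real_inner_smul_left,
    smul_eq_mul]
  ring

/-- The Blaschke tensor as a bundled bilinear map. -/
noncomputable def blaschkeBilin (H : IsImmersionNear F u) (hρ : 0 < rho F u) :
    Euc n →ₗ[ℝ] Euc n →ₗ[ℝ] ℝ :=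
  LinearMap.mk₂ ℝ (blaschke F u)
    (fun X Y Z => by
      rw [H.blaschke_comm hρ, H.blaschke_add_right hρ, H.blaschke_comm hρ Z,
        H.blaschke_comm hρ Z])
    (fun c X Z => by rw [H.blaschke_comm hρ, H.blaschke_smul_right hρ, H.blaschke_comm hρ Z])
    (H.blaschke_add_right hρ) (H.blaschke_smul_right hρ)

/-- The space `E_η`, as a linear subspace. -/
def principalSpace (H : IsImmersionNear F u) (η : Euc m) : Submodule ℝ (Euc n) where
  carrier := {X | ∀ Y, secondFundamentalForm F u X Y = inducedMetric F u X Y • η}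
  add_mem' {X Z} hX hZ Y := by
    rw [← H.sff_apply, map_add, LinearMap.add_apply, H.sff_apply, H.sff_apply, hX, hZ,
      H.isInnerForm.add_left, add_smul]
  zero_mem' Y := by
    rw [← H.sff_apply, map_zero, LinearMap.zero_apply, H.isInnerForm.zero_left, zero_smul]
  smul_mem' c X hX Y := by
    rw [← H.sff_apply, map_smul, LinearMap.smul_apply, H.sff_apply, hX,
      H.isInnerForm.smul_left, smul_smul]

/-- `η` is a principal normal at `u`. -/
def IsPrincipalNormal (H : IsImmersionNear F u) (η : Euc m) : Prop :=
  η ∈ normalSpace F u ∧ ∃ X, X ≠ 0 ∧ X ∈ H.principalSpace η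

/-- A vector `η` with `E_η ≠ 0` is automatically normal, since `α(X, X) = ⟨X, X⟩ η`. -/
lemma isPrincipalNormal_of_mem (H : IsImmersionNear F u) {η : Euc m} {X : Euc n} (hX : X ≠ 0)
    (h : X ∈ H.principalSpace η) : H.IsPrincipalNormal η := by
  refine ⟨?_, X, hX, h⟩
  have h1 : η = (inducedMetric F u X X)⁻¹ • secondFundamentalForm F u X X := by
    rw [h X, inv_smul_smul₀ (H.inducedMetric_pos hX).ne']
  rw [h1]
  exact Submodule.smul_mem _ _ (secondFundamentalForm_mem _ _)

/-- The shape operator as a bundled linear map. -/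
noncomputable def shapeLin (H : IsImmersionNear F u) (ξ : Euc m) : Euc n →ₗ[ℝ] Euc n where
  toFun := H.shape ξ
  map_add' X Y := H.isInnerForm.ext_right fun Z => by
    rw [H.isInnerForm.add_left, H.inducedMetric_shape, H.inducedMetric_shape,
      H.inducedMetric_shape, ← H.sff_apply, map_add, LinearMap.add_apply, inner_add_right,
      H.sff_apply, H.sff_apply]
  map_smul' c X := H.isInnerForm.ext_right fun Z => by
    rw [RingHom.id_apply, H.isInnerForm.smul_left, H.inducedMetric_shape, H.inducedMetric_shape,
      ← H.sff_apply, map_smul, LinearMap.smul_apply, real_inner_smul_right, H.sff_apply]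

/-- If the normal bundle is flat, then the tangent space is spanned by the spaces `E_η` of the
principal normals: these are the joint eigenspaces of the commuting shape operators. -/
lemma iSup_principalSpace (H : IsImmersionNear F u)
    (hflat : ∀ X Y, ∀ ξ ∈ normalSpace F u, normalCurvature F u X Y ξ = 0) :
    ⨆ η : {η // H.IsPrincipalNormal η}, H.principalSpace η = ⊤ := by
  have h1 := iSup_iInf_eigenspace_eq_top (b := H.isInnerForm.toBilin) (ι := Fin m)
    (T := fun i => H.shapeLin (stdVec i)) H.isInnerForm.symm (fun X hX => H.inducedMetric_pos hX)
    (fun i X Y => H.inducedMetric_shape_comm _ X Y)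
    fun i j X => H.shape_shape_comm hflat (stdVec i) (stdVec j) X
  rw [eq_top_iff, ← h1]
  refine iSup_le fun χ X hX => ?_
  rcases eq_or_ne X 0 with rfl | hX0
  · exact Submodule.zero_mem _
  have hmem : X ∈ H.principalSpace (WithLp.toLp 2 χ) := by
    intro Y
    ext i
    have h2 : H.shape (stdVec i) X = χ i • X :=
      Module.End.mem_eigenspace_iff.1 ((Submodule.mem_iInf _).1 hX i)
    have h3 := H.inducedMetric_shape (stdVec i) X Y
    rw [h2, H.isInnerForm.smul_left, stdVec, EuclideanSpace.inner_single_left] at h3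
    simp only [map_one, one_mul] at h3
    rw [← h3]
    simp [mul_comm]
  exact Submodule.mem_iSup_of_mem (p := fun η : {η // H.IsPrincipalNormal η} => H.principalSpace η)
    ⟨_, H.isPrincipalNormal_of_mem hX0 hmem⟩ hmem

/-- If `E_η` is the whole tangent space, then `η` is the mean curvature vector. -/
lemma meanCurvature_eq (H : IsImmersionNear F u) (hn : n ≠ 0) {η : Euc m}
    (h : ∀ X Y, secondFundamentalForm F u X Y = inducedMetric F u X Y • η) :
    meanCurvature F u = η := by
  have h1 : ∀ j, ∑ i, (gram (inducedMetric F u))⁻¹ i j •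
      secondFundamentalForm F u (stdVec i) (stdVec j) = η := by
    intro j
    simp only [h, smul_smul, ← Finset.sum_smul]
    have := H.isInnerForm.sum_inv_gram_mul j j
    rw [if_pos rfl] at this
    exact (congrArg (· • η) this).trans (one_smul _ _)
  rw [meanCurvature, Finset.sum_comm]
  simp only [h1, Finset.sum_const, Finset.card_univ, Fintype.card_fin]
  rw [← Nat.cast_smul_eq_nsmul ℝ, smul_smul, one_div_mul_cancel (Nat.cast_ne_zero.2 hn), one_smul]

/-- The tensors of an immersion with flat normal bundle at a non-umbilical point, diagonalized by the
spaces `E_η` with the Moebius principal normals as values. -/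
lemma diagonalizedGauss (H : IsImmersionNear F u) (hn : 3 ≤ n) (hρ : 0 < rho F u)
    (hu : ¬ ∀ X Y, secondFundamentalForm F u X Y = inducedMetric F u X Y • meanCurvature F u)
    (hflat : ∀ X Y, ∀ ξ ∈ normalSpace F u, normalCurvature F u X Y ξ = 0) :
    DiagonalizedGauss (H.isPullbackNear_moebius hρ).isInnerForm.toBilin H.betaBilin
      (H.blaschkeBilin hρ) (curvature (moebiusMetric F) u)
      (fun η : {η // H.IsPrincipalNormal η} => H.principalSpace η)
      (fun η => (rho F u)⁻¹ • (η.1 - meanCurvature F u)) where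
  h_symm := (H.isPullbackNear_moebius hρ).isInnerForm.symm
  h_pos X hX := mul_pos (by positivity) (H.inducedMetric_pos hX)
  β_symm := H.beta_comm
  ψ_symm := H.blaschke_comm hρ
  gauss := H.moebius_gauss_equation hρ
  β_eq := by
    rintro ⟨η, hη⟩ X hX Y
    change beta F u X Y = moebiusMetric F u X Y • _
    rw [beta, moebiusMetric, hX Y, ← smul_sub, smul_smul, smul_smul]
    congr 1
    field_simp
  ν_injective := by
    rintro ⟨η, hη⟩ ⟨ζ, hζ⟩ h
    have := smul_right_injective (Euc m) (inv_ne_zero hρ.ne') h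
    exact Subtype.ext (sub_left_injective this)
  iSup_E := H.iSup_principalSpace hflat
  exists_ne_zero := by
    rintro ⟨η, h1, X, hX0, hX⟩
    exact ⟨X, hX, hX0⟩
  E_ne_top := by
    rintro ⟨η, hη⟩ htop
    have h1 : ∀ X Y, secondFundamentalForm F u X Y = inducedMetric F u X Y • η := by
      intro X
      have : X ∈ H.principalSpace η := by
        change H.principalSpace η = ⊤ at htop
        rw [htop]
        exact Submodule.mem_top
      exact this
    apply hu
    rwa [H.meanCurvature_eq (by omega) h1]

/-- The characterization of Moebius semi-parallel immersions at a point of a chart. -/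
theorem curvatureActBeta_eq_zero_iff (H : IsImmersionNear F u) (hn : 3 ≤ n)
    (hu : ¬ ∀ X Y, secondFundamentalForm F u X Y = inducedMetric F u X Y • meanCurvature F u)
    (hflat : ∀ X Y, ∀ ξ ∈ normalSpace F u, normalCurvature F u X Y ξ = 0) :
    (∀ X Y Z W, curvatureActBeta F u X Y Z W = 0) ↔
      ∃ θ : Euc m → ℝ,
        (∀ η, H.IsPrincipalNormal η → ∀ X ∈ H.principalSpace η, ∀ Y,
          blaschke F u X Y = θ η * moebiusMetric F u X Y) ∧
        ∀ η, H.IsPrincipalNormal η → ∀ ζ, H.IsPrincipalNormal ζ → η ≠ ζ →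
          inner ℝ ((rho F u)⁻¹ • (η - meanCurvature F u)) ((rho F u)⁻¹ • (ζ - meanCurvature F u))
            + θ η + θ ζ = 0 := by
  have hρ : 0 < rho F u := Real.sqrt_pos.2 (H.rho_radicand_pos (by omega) hu)
  have hbeta : ∀ Z W, beta F u Z W ∈ normalSpace F u := fun Z W =>
    Submodule.smul_mem _ _ <| Submodule.sub_mem _ (secondFundamentalForm_mem Z W) <|
      Submodule.smul_mem _ _ <| Submodule.smul_mem _ _ <| Submodule.sum_mem _ fun i _ =>
        Submodule.sum_mem _ fun j _ => Submodule.smul_mem _ _ (secondFundamentalForm_mem _ _)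
  have hact : ∀ X Y Z W, curvatureActBeta F u X Y Z W = 0 ↔
      H.betaBilin (curvature (moebiusMetric F) u X Y Z) W
        + H.betaBilin Z (curvature (moebiusMetric F) u X Y W) = 0 := by
    intro X Y Z W
    rw [curvatureActBeta, hflat X Y _ (hbeta Z W), zero_sub, sub_eq_add_neg, ← neg_add,
      neg_eq_zero]
    rfl
  simp only [hact]
  rw [(H.diagonalizedGauss hn hρ hu hflat).act_eq_zero_iff_exists (by simpa using hn)]
  classical
  constructor
  · rintro ⟨θ, h1, h2⟩
    refine ⟨fun η => if hη : H.IsPrincipalNormal η then θ ⟨η, hη⟩ else 0, ?_, ?_⟩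
    · intro η hη X hX Y
      beta_reduce
      rw [dif_pos hη]
      exact h1 ⟨η, hη⟩ X hX Y
    · intro η hη ζ hζ hne
      beta_reduce
      rw [dif_pos hη, dif_pos hζ]
      exact h2 ⟨η, hη⟩ ⟨ζ, hζ⟩ fun e => hne (congrArg Subtype.val e)
  · rintro ⟨θ, h1, h2⟩
    exact ⟨fun η => θ η, fun η X hX Y => h1 η η.2 X hX Y,
      fun η ζ hne => h2 η η.2 ζ ζ.2 fun e => hne (Subtype.ext e)⟩

end IsImmersionNear

end Param

section Manifold

variable {n m : ℕ} {M : Type*} [TopologicalSpace M] [ChartedSpace (Euc n) M]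
  [IsManifold (𝓡 n) ∞ M]

/-- In the preferred chart at `x` an immersion satisfies the hypotheses of the pointwise
characterization. -/
lemma IsSmoothImmersion.isImmersionNear {f : M → Euc m} (hf : IsSmoothImmersion n f) (x : M) :
    Param.IsImmersionNear (localRep n f x) (coord n x) where
  smooth := by
    have h1 : ContDiffOn ℝ ∞ (localRep n f x) (extChartAt (𝓡 n) x).target :=
      (hf.1.comp_contMDiffOn (contMDiffOn_extChartAt_symm x)).contDiffOn
    filter_upwards [(isOpen_extChartAt_target x).mem_nhds (mem_extChartAt_target x)] with v hv
    exact h1.contDiffAt ((isOpen_extChartAt_target x).mem_nhds hv)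
  injective := by
    have h1 := hf.2 x
    have h2 : MDifferentiableAt (𝓡 n) 𝓘(ℝ, Euc m) f x := hf.1.mdifferentiableAt (by simp)
    rw [h2.mfderiv, ModelWithCorners.range_eq_univ, fderivWithin_univ] at h1
    exact h1

end Manifold


end MoebiusGeometry

theorem lemma2p2 {n m : ℕ} (hn : 3 ≤ n) {M : Type*} [TopologicalSpace M]
    [ChartedSpace (MoebiusGeometry.Euc n) M] [IsManifold (𝓡 n) ∞ M]
    (f : M → MoebiusGeometry.Euc m)
    (hf : MoebiusGeometry.IsSmoothImmersion n f)
    (humb : MoebiusGeometry.IsUmbilicFree n f)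
    (hflat : MoebiusGeometry.HasFlatNormalBundle n f) :
    MoebiusGeometry.IsMoebiusSemiParallel n f ↔
      ∀ x : M, ∃ θ : MoebiusGeometry.Euc m → ℝ,
        (∀ η ∈ MoebiusGeometry.principalNormals n f x,
          ∀ X ∈ MoebiusGeometry.eigenspace f x η, ∀ Y : TangentSpace (𝓡 n) x,
            MoebiusGeometry.blaschke f x X Y = θ η * MoebiusGeometry.moebiusMetric f x X Y) ∧
        (∀ η ∈ MoebiusGeometry.principalNormals n f x,
          ∀ ζ ∈ MoebiusGeometry.principalNormals n f x, η ≠ ζ →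
            inner ℝ (MoebiusGeometry.moebiusNormal n f x η)
              (MoebiusGeometry.moebiusNormal n f x ζ) + θ η + θ ζ = 0) :=
  forall_congr' fun x =>
    (hf.isImmersionNear x).curvatureActBeta_eq_zero_iff hn (humb x) (hflat x)
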